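/- Let $U\subseteq\mathbb C$ be open and let $\Gamma$ be a subgroup of $\mathrm{SL}(2,\mathbb C)$ such that $\frac{az+b}{cz+d}\in U$ whenever $z\in U$, $\gamma=\left(\begin{smallmatrix}a&b\\c&d\end{smallmatrix}\right)\in\Gamma$ and $cz+d\neq0$. Let $R$ be a $\mathbb C$-algebra of functions of the variable $z\in U$ (each holomorphic outside a relatively closed countable subset of $U$, two functions being identified when they agree outside such a subset; this allows holomorphic, meromorphic and rational functions). Assume that $R$ is an integral domain, that $f\cdot\gamma\in R$ for all $f\in R$ and $\gamma\in\Gamma$, where $(f\cdot\gamma)(z)=f\!\left(\frac{az+b}{cz+d}\right)$, that $cz+d$ is an invertible element of $R$ for every $\gamma\in\Gamma$, and that $R$ is stable under the derivation $\partial_z$. Put $\delta=-\frac12\partial_z$ and let $C=R(\!(y;\delta)\!)_2$ be the ring of formal Laurent series $\sum_{n\ge m}f_ny^n$ ($m\in\mathbb Z$, $f_n\in R$) with the noncommutative product determined by $$y^if=\sum_{j\ge0}\Big(\prod_{l=1}^{j}\frac{2(l-1)+i}{l}\Big)\,\delta^j(f)\,y^{2j+i}\qquad(i\in\mathbb Z,\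 f\in R).$$ For $\gamma\in\Gamma$ let $y\cdot\gamma\in C$ be the unique series of the form $(cz+d)^{-1}y+\cdots$ (higher powers of $y$) whose square is $y^2(cz+d)^{-2}$; it is invertible in $C$. The homographic action is extended to $C$ by $\big(\sum_n f_ny^n\big)\cdot\gamma=\sum_n(f_n\cdot\gamma)(y\cdot\gamma)^n$. Then for every $k\in\mathbb Z$ and every $\gamma=\left(\begin{smallmatrix}a&b\\c&d\end{smallmatrix}\right)\in\Gamma$, $$y^k\cdot\gamma=\sum_{u\ge0}\omega_k(u)\,(cz+d)^{-k}\Big(\frac{c}{cz+d}\Big)^{u}\,y^{2u+k},$$ where $\omega_k(0)=1$ and $\omega_k(u)=\frac1{4^u\,u!}\prod_{i=0}^{u-1}(k+2i)(k+2i+2)$ for $u\ge1$. -/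

import Mathlib

open Finset in
/-- The coefficient `∏_{j=1}^{k} (2 (j - 1) + i) / j`. -/
def qpdoCoeff (K : Type*) [Field K] (i : ℤ) (k : ℕ) : K :=
  ∏ j ∈ range k, (2 * (j : K) + (i : K)) / ((j : K) + 1)

section Coefficients

variable {K : Type*} [Field K]

theorem qpdoCoeff_zero_right (i : ℤ) : qpdoCoeff K i 0 = 1 := by simp [qpdoCoeff]

theorem qpdoCoeff_zero_left (k : ℕ) : qpdoCoeff K 0 (k + 1) = 0 := by
  simp [qpdoCoeff, Finset.prod_range_succ']

theorem qpdoCoeff_succ [CharZero K] (i : ℤ) (k : ℕ) :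
    ((k : K) + 1) * qpdoCoeff K i (k + 1) = (2 * (k : K) + (i : K)) * qpdoCoeff K i k := by
  have : (k : K) + 1 ≠ 0 := Nat.cast_add_one_ne_zero k
  rw [qpdoCoeff, Finset.prod_range_succ, ← qpdoCoeff]
  field_simp

theorem qpdoCoeff_add [CharZero K] (a b : ℤ) (n : ℕ) :
    qpdoCoeff K (a + b) n =
      ∑ p ∈ Finset.HasAntidiagonal.antidiagonal n, qpdoCoeff K a p.1 * qpdoCoeff K b p.2 := by
  induction n with
  | zero => simp [qpdoCoeff_zero_right]
  | succ n ih =>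
    have hn : (n : K) + 1 ≠ 0 := Nat.cast_add_one_ne_zero n
    apply mul_left_cancel₀ hn
    rw [qpdoCoeff_succ, ih, Finset.mul_sum]
    have h1 : ((n : K) + 1) * ∑ p ∈ Finset.HasAntidiagonal.antidiagonal (n + 1),
        qpdoCoeff K a p.1 * qpdoCoeff K b p.2 =
        (∑ p ∈ Finset.HasAntidiagonal.antidiagonal (n + 1), (p.1 : K) * (qpdoCoeff K a p.1 * qpdoCoeff K b p.2)) +
        ∑ p ∈ Finset.HasAntidiagonal.antidiagonal (n + 1), (p.2 : K) * (qpdoCoeff K a p.1 * qpdoCoeff K b p.2) := by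
      rw [Finset.mul_sum, ← Finset.sum_add_distrib]
      refine Finset.sum_congr rfl fun p hp => ?_
      rw [Finset.HasAntidiagonal.mem_antidiagonal] at hp
      have : (n : K) + 1 = p.1 + p.2 := by exact_mod_cast hp.symm
      rw [this]; ring
    rw [h1, Finset.Nat.sum_antidiagonal_succ, Finset.Nat.sum_antidiagonal_succ']
    simp only [Nat.cast_zero, zero_mul, zero_add, Nat.cast_add, Nat.cast_one]
    rw [← Finset.sum_add_distrib]
    refine Finset.sum_congr rfl fun p hp => ?_
    rw [Finset.HasAntidiagonal.mem_antidiagonal] at hp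
    have h2 := qpdoCoeff_succ (K := K) a p.1
    have h3 := qpdoCoeff_succ (K := K) b p.2
    have : (n : K) = p.1 + p.2 := by exact_mod_cast hp.symm
    rw [this]; push_cast
    linear_combination (-qpdoCoeff K b p.2) * h2 - (qpdoCoeff K a p.1) * h3

theorem qpdoCoeff_mul_choose [CharZero K] (i : ℤ) (p r : ℕ) :
    qpdoCoeff K i (p + r) * ((p + r).choose p : K) =
      qpdoCoeff K i p * qpdoCoeff K (i + 2 * p) r := by
  induction r with
  | zero => simp [qpdoCoeff_zero_right]
  | succ r ih =>
    have hn : (r : K) + 1 ≠ 0 := Nat.cast_add_one_ne_zero r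
    apply mul_left_cancel₀ hn
    have h1 := qpdoCoeff_succ (K := K) i (p + r)
    have h2 := qpdoCoeff_succ (K := K) (i + 2 * p) r
    have h3 : ((r : K) + 1) * ((p + (r + 1)).choose p : K) =
        ((p : K) + r + 1) * ((p + r).choose p : K) := by
      have := Nat.choose_mul_succ_eq (p + r) p
      have h4 : p + r + 1 - p = r + 1 := by omega
      rw [h4] at this
      have h5 : ((p + r).choose p : K) * ((p : K) + r + 1) =
        ((p + r + 1).choose p : K) * ((r : K) + 1) := by exact_mod_cast this
      rw [← add_assoc p r 1]
      linear_combination -h5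
    push_cast at h1 h2 ⊢
    rw [← add_assoc p r 1] at *
    linear_combination (qpdoCoeff K i (p + r + 1)) * h3 + ((p + r).choose p : K) * h1
      - qpdoCoeff K i p * h2 + (2 * (p + r : K) + i) * ih

theorem derivation_iterate_mul {R : Type*} [CommRing R] [Algebra K R] (δ : Derivation K R R)
    (n : ℕ) (f g : R) : δ^[n] (f * g) =
      ∑ p ∈ Finset.HasAntidiagonal.antidiagonal n, (n.choose p.1 : K) • (δ^[p.1] f * δ^[p.2] g) := by
  induction n with
  | zero => simp
  | succ n ih =>
    have key := Finset.sum_antidiagonal_choose_succ_nsmul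
      (fun a b => δ^[a] f * δ^[b] g) n
    simp only [Nat.cast_smul_eq_nsmul] at ih ⊢
    rw [key, Function.iterate_succ_apply', ih, map_sum, ← Finset.sum_add_distrib]
    refine Finset.sum_congr rfl fun p hp => ?_
    have hp' : p.2 = n - p.1 := by
      rw [Finset.HasAntidiagonal.mem_antidiagonal] at hp; omega
    rw [map_nsmul, Derivation.leibniz, ← Function.iterate_succ_apply' (⇑δ),
      ← Function.iterate_succ_apply' (⇑δ), smul_add, smul_eq_mul, smul_eq_mul,
      mul_comm (δ^[p.2] g)]
    rw [Finset.HasAntidiagonal.mem_antidiagonal] at hp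
    rw [← Nat.choose_symm_of_eq_add hp.symm]

end Coefficients

/-- Formal Laurent series `∑_{i ≥ m} f_i y^i` (`m ∈ ℤ`, `f_i ∈ R`), which carry below the
noncommutative product determined by
`y^i f = ∑_{k ≥ 0} (∏_{j=1}^{k} (2 (j - 1) + i) / j) δ^k(f) y^{2k+i}`:
the ring `R((y ; δ))₂` of quadratic formal pseudodifferential operators. -/
def QPDO {K R : Type*} [Field K] [CommRing R] [Algebra K R] (_δ : Derivation K R R) : Type _ :=
  HahnSeries ℤ R

namespace QPDO

variable {K R : Type*} [Field K] [CommRing R] [Algebra K R] {δ : Derivation K R R}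

noncomputable instance : AddCommGroup (QPDO δ) := inferInstanceAs (AddCommGroup (HahnSeries ℤ R))

/-- The coefficient of `y^n`. -/
def coeff (q : QPDO δ) (n : ℤ) : R := HahnSeries.coeff q n

@[ext] theorem ext {q r : QPDO δ} (h : ∀ n, q.coeff n = r.coeff n) : q = r :=
  HahnSeries.ext (funext h)

@[simp] theorem coeff_zero (n : ℤ) : (0 : QPDO δ).coeff n = 0 := rfl
@[simp] theorem coeff_add (q r : QPDO δ) (n : ℤ) : (q + r).coeff n = q.coeff n + r.coeff n := rfl
@[simp] theorem coeff_neg (q : QPDO δ) (n : ℤ) : (-q).coeff n = -q.coeff n := rfl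
@[simp] theorem coeff_sub (q r : QPDO δ) (n : ℤ) : (q - r).coeff n = q.coeff n - r.coeff n := rfl

/-- The series with given coefficients, all zero below some index. -/
noncomputable def ofCoeff (f : ℤ → R) (hf : ∃ m : ℤ, ∀ i < m, f i = 0) : QPDO δ :=
  HahnSeries.ofSuppBddBelow f
    (hf.elim fun m hm => ⟨m, fun i hi => not_lt.mp fun h => hi (hm i h)⟩)

@[simp] theorem coeff_ofCoeff (f : ℤ → R) (hf : ∃ m : ℤ, ∀ i < m, f i = 0) (n : ℤ) :
    (ofCoeff f hf : QPDO δ).coeff n = f n := rfl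

/-- `VGe q m` says that `q` has `y`-valuation at least `m`. -/
def VGe (q : QPDO δ) (m : ℤ) : Prop := ∀ i < m, q.coeff i = 0

theorem exists_vGe (q : QPDO δ) : ∃ m, VGe q m := by
  by_cases h : (HahnSeries.support (q : HahnSeries ℤ R)).Nonempty
  · refine ⟨(HahnSeries.isWF_support (q : HahnSeries ℤ R)).min h, fun i hi => ?_⟩
    by_contra hne
    exact Set.IsWF.not_lt_min _ h (show i ∈ HahnSeries.support (q : HahnSeries ℤ R) from hne) hi
  · refine ⟨0, fun i _ => ?_⟩
    by_contra hne
    exact h ⟨i, hne⟩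

theorem VGe.mono {q : QPDO δ} {m n : ℤ} (h : VGe q m) (hn : n ≤ m) : VGe q n :=
  fun i hi => h i (by omega)

/-- The monomial `f y^i`. -/
noncomputable def monomial (i : ℤ) (f : R) : QPDO δ :=
  ofCoeff (fun n => if n = i then f else 0) ⟨i, fun n hn => if_neg (by omega)⟩

theorem coeff_monomial (i : ℤ) (f : R) (n : ℤ) :
    (monomial i f : QPDO δ).coeff n = if n = i then f else 0 := rfl

theorem vGe_monomial (i : ℤ) (f : R) : VGe (monomial i f : QPDO δ) i :=
  fun n hn => if_neg (by omega)

/-- The contribution of `f_i y^i` and of `δ^k` to the coefficient of `y^n` in a product. -/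
noncomputable def mulTerm (q r : QPDO δ) (n : ℤ) (p : ℤ × ℕ) : R :=
  qpdoCoeff K p.1 p.2 • (q.coeff p.1 * δ^[p.2] (r.coeff (n - p.1 - 2 * p.2)))

theorem iterate_zero' (k : ℕ) : δ^[k] (0 : R) = 0 := by
  induction k with
  | zero => rfl
  | succ k ih => rw [Function.iterate_succ_apply', ih, map_zero]

theorem iterate_add' (k : ℕ) (f g : R) : δ^[k] (f + g) = δ^[k] f + δ^[k] g := by
  induction k generalizing f g with
  | zero => rfl
  | succ k ih => rw [Function.iterate_succ_apply, map_add, ih, Function.iterate_succ_apply,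
      Function.iterate_succ_apply]

theorem mulTerm_ne {q r : QPDO δ} {a b : ℤ} (hq : VGe q a) (hr : VGe r b) {n : ℤ} {p : ℤ × ℕ}
    (h : mulTerm q r n p ≠ 0) : a ≤ p.1 ∧ p.1 + 2 * p.2 ≤ n - b := by
  constructor
  · by_contra hlt
    exact h (by rw [mulTerm, hq _ (by omega), zero_mul, smul_zero])
  · by_contra hlt
    exact h (by rw [mulTerm, hr _ (by omega), iterate_zero', mul_zero, smul_zero])

theorem mulTerm_finite (q r : QPDO δ) (n : ℤ) : (Function.support (mulTerm q r n)).Finite := by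
  obtain ⟨a, ha⟩ := exists_vGe q
  obtain ⟨b, hb⟩ := exists_vGe r
  refine ((Set.finite_Icc a (n - b)).prod (Set.finite_Iic (n - b - a).toNat)).subset ?_
  intro p hp
  have := mulTerm_ne ha hb hp
  simp only [Set.mem_prod, Set.mem_Icc, Set.mem_Iic]
  omega

noncomputable instance : Mul (QPDO δ) where
  mul q r := ofCoeff (fun n => ∑ᶠ p : ℤ × ℕ, qpdoCoeff K p.1 p.2 •
      (q.coeff p.1 * δ^[p.2] (r.coeff (n - p.1 - 2 * p.2)))) <| by
    obtain ⟨a, ha⟩ := exists_vGe q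
    obtain ⟨b, hb⟩ := exists_vGe r
    refine ⟨a + b, fun n hn => finsum_eq_zero_of_forall_eq_zero fun p => ?_⟩
    by_contra h
    have := mulTerm_ne ha hb h
    omega

theorem coeff_mul (q r : QPDO δ) (n : ℤ) : (q * r).coeff n = ∑ᶠ p, mulTerm q r n p := rfl

noncomputable instance : One (QPDO δ) := ⟨monomial 0 1⟩

theorem one_def : (1 : QPDO δ) = monomial 0 1 := rfl

theorem VGe.coeff_mul_eq {q r : QPDO δ} {a b : ℤ} (hq : VGe q a) (hr : VGe r b) :
    (q * r).coeff (a + b) = q.coeff a * r.coeff b := by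
  rw [coeff_mul, finsum_eq_single _ (a, 0)]
  · simp [mulTerm, qpdoCoeff_zero_right]
  · rintro ⟨i, k⟩ hne
    by_contra h
    have := mulTerm_ne hq hr h
    refine hne (Prod.ext ?_ ?_) <;> simp only at this ⊢ <;> omega

theorem VGe.mul {q r : QPDO δ} {a b : ℤ} (hq : VGe q a) (hr : VGe r b) : VGe (q * r) (a + b) := by
  intro n hn
  rw [coeff_mul]
  refine finsum_eq_zero_of_forall_eq_zero fun p => ?_
  by_contra h
  have := mulTerm_ne hq hr h
  omega

theorem VGe.add {q r : QPDO δ} {a : ℤ} (hq : VGe q a) (hr : VGe r a) : VGe (q + r) a :=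
  fun i hi => by rw [coeff_add, hq i hi, hr i hi, add_zero]

protected theorem left_distrib' (q r s : QPDO δ) : q * (r + s) = q * r + q * s := by
  ext n
  rw [coeff_add, coeff_mul, coeff_mul, coeff_mul,
    ← finsum_add_distrib (mulTerm_finite q r n) (mulTerm_finite q s n)]
  refine finsum_congr fun p => ?_
  simp only [mulTerm, coeff_add, iterate_add', mul_add, smul_add]

protected theorem right_distrib' (q r s : QPDO δ) : (q + r) * s = q * s + r * s := by
  ext n
  rw [coeff_add, coeff_mul, coeff_mul, coeff_mul,
    ← finsum_add_distrib (mulTerm_finite q s n) (mulTerm_finite r s n)]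
  refine finsum_congr fun p => ?_
  simp only [mulTerm, coeff_add, add_mul, smul_add]

theorem coeff_monomial_mul (i : ℤ) (f : R) {r : QPDO δ} {n : ℤ} {N : ℕ}
    (hr : VGe r (n - i - 2 * N)) :
    (monomial i f * r).coeff n = ∑ k ∈ Finset.range (N + 1),
      qpdoCoeff K i k • (f * δ^[k] (r.coeff (n - i - 2 * k))) := by
  have hsub : Function.support (mulTerm (monomial i f) r n) ⊆
      ((Finset.range (N + 1)).map ⟨fun k => (i, k), fun a b h => by simpa using h⟩ :
        Finset (ℤ × ℕ)) := by
    rintro ⟨j, k⟩ hp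
    have h2 := mulTerm_ne (vGe_monomial i f) hr hp
    have h1 : j = i := by
      by_contra hne
      exact hp (by simp [mulTerm, coeff_monomial, hne])
    subst h1
    simp only [Finset.coe_map, Set.mem_image, Finset.mem_coe,
      Finset.mem_range]
    exact ⟨k, by simp only at h2; omega, rfl⟩
  rw [coeff_mul, finsum_eq_sum_of_support_subset _ hsub, Finset.sum_map]
  refine Finset.sum_congr rfl fun k _ => ?_
  change mulTerm (monomial i f) r n (i, k) = _
  simp [mulTerm, coeff_monomial]

theorem coeff_mul_monomial (l : ℤ) (h : R) {q : QPDO δ} {n : ℤ} {N : ℕ}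
    (hq : VGe q (n - l - 2 * N)) :
    (q * monomial l h).coeff n = ∑ k ∈ Finset.range (N + 1),
      qpdoCoeff K (n - l - 2 * k) k • (q.coeff (n - l - 2 * k) * δ^[k] h) := by
  have hsub : Function.support (mulTerm q (monomial l h) n) ⊆
      ((Finset.range (N + 1)).map ⟨fun k : ℕ => (n - l - 2 * (k : ℤ), k),
        fun a b h => by simp only [Prod.mk.injEq] at h; exact h.2⟩ : Finset (ℤ × ℕ)) := by
    rintro ⟨j, k⟩ hp
    have h2 := mulTerm_ne hq (vGe_monomial l h) hp
    have h1 : n - j - 2 * k = l := by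
      by_contra hne
      exact hp (by simp [mulTerm, coeff_monomial, hne])
    simp only [Finset.coe_map, Set.mem_image, Finset.mem_coe,
      Finset.mem_range]
    refine ⟨k, by simp only at h2; omega, Prod.ext ?_ rfl⟩
    change n - l - 2 * (k : ℤ) = j
    omega
  rw [coeff_mul, finsum_eq_sum_of_support_subset _ hsub, Finset.sum_map]
  refine Finset.sum_congr rfl fun k _ => ?_
  change mulTerm q (monomial l h) n (n - l - 2 * (k : ℤ), k) = _
  have : n - (n - l - 2 * (k : ℤ)) - 2 * k = l := by ring
  simp [mulTerm, coeff_monomial, this]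

theorem coeff_monomial_mul_monomial (i j : ℤ) (f g : R) (a : ℕ) :
    (monomial i f * monomial j g : QPDO δ).coeff (i + j + 2 * a) =
      qpdoCoeff K i a • (f * δ^[a] g) := by
  rw [coeff_monomial_mul (N := a) i f ((vGe_monomial j g).mono (by omega)),
    Finset.sum_eq_single a]
  · rw [coeff_monomial, if_pos (by omega)]
  · intro b _ hb
    rw [coeff_monomial, if_neg (by omega), iterate_zero', mul_zero, smul_zero]
  · simp

theorem coeff_monomial_mul_monomial_of_ne (i j : ℤ) (f g : R) (n : ℤ)
    (hn : ∀ a : ℕ, n ≠ i + j + 2 * a) :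
    (monomial i f * monomial j g : QPDO δ).coeff n = 0 := by
  rw [coeff_mul]
  refine finsum_eq_zero_of_forall_eq_zero fun p => ?_
  by_cases h1 : p.1 = i
  · rw [mulTerm, coeff_monomial, coeff_monomial, if_neg (c := _ = j), iterate_zero', mul_zero,
      smul_zero]
    intro h2
    exact hn p.2 (by omega)
  · rw [mulTerm, coeff_monomial, if_neg h1, zero_mul, smul_zero]

protected theorem monomial_assoc [CharZero K] (i j l : ℤ) (f g h : R) :
    (monomial i f * monomial j g * monomial l h : QPDO δ) =
      monomial i f * (monomial j g * monomial l h) := by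
  ext n
  obtain ⟨M, hM⟩ : ∃ M : ℕ, n - i - j - l ≤ 2 * M := ⟨(n - i - j - l).toNat, by omega⟩
  have v1 := (vGe_monomial (δ := δ) i f).mul (vGe_monomial (δ := δ) j g)
  have v2 := (vGe_monomial (δ := δ) j g).mul (vGe_monomial (δ := δ) l h)
  by_cases hn : ∃ N : ℕ, n = i + j + l + 2 * N
  · obtain ⟨N, rfl⟩ := hn
    rw [coeff_mul_monomial (N := N) l h (v1.mono (by omega)),
      coeff_monomial_mul (N := N) i f (v2.mono (by omega)),
      ← Finset.Nat.sum_antidiagonal_eq_sum_range_succ_mk (fun p : ℕ × ℕ =>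
        qpdoCoeff K (i + j + l + 2 * N - l - 2 * p.1) p.1 •
          ((monomial i f * monomial j g : QPDO δ).coeff (i + j + l + 2 * N - l - 2 * p.1) *
            δ^[p.1] h)),
      ← Finset.Nat.sum_antidiagonal_eq_sum_range_succ_mk (fun p : ℕ × ℕ =>
        qpdoCoeff K i p.1 • (f * δ^[p.1]
          ((monomial j g * monomial l h : QPDO δ).coeff (i + j + l + 2 * N - i - 2 * p.1))))]
    have e1 : ∀ p ∈ Finset.HasAntidiagonal.antidiagonal N,
        qpdoCoeff K (i + j + l + 2 * N - l - 2 * p.1) p.1 •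
          ((monomial i f * monomial j g : QPDO δ).coeff (i + j + l + 2 * N - l - 2 * p.1) *
            δ^[p.1] h) =
        ∑ t ∈ Finset.HasAntidiagonal.antidiagonal p.1,
          (qpdoCoeff K i p.2 * qpdoCoeff K (i + 2 * p.2) t.1 * qpdoCoeff K j t.2) •
            (f * δ^[p.2] g * δ^[t.1 + t.2] h) := by
      intro p hp
      rw [Finset.HasAntidiagonal.mem_antidiagonal] at hp
      have h1 : i + j + l + 2 * (N : ℤ) - l - 2 * p.1 = i + j + 2 * p.2 := by
        rw [← hp]; push_cast; ring
      rw [h1, coeff_monomial_mul_monomial,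
        show i + j + 2 * (p.2 : ℤ) = (i + 2 * p.2) + j by ring, qpdoCoeff_add, Finset.sum_smul]
      refine Finset.sum_congr rfl fun t ht => ?_
      rw [Finset.HasAntidiagonal.mem_antidiagonal] at ht
      rw [ht, smul_mul_assoc, smul_smul]
      congr 1; ring
    have e2 : ∀ p ∈ Finset.HasAntidiagonal.antidiagonal N,
        qpdoCoeff K i p.1 • (f * δ^[p.1]
          ((monomial j g * monomial l h : QPDO δ).coeff (i + j + l + 2 * N - i - 2 * p.1))) =
        ∑ t ∈ Finset.HasAntidiagonal.antidiagonal p.1,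
          (qpdoCoeff K i t.1 * qpdoCoeff K (i + 2 * t.1) t.2 * qpdoCoeff K j p.2) •
            (f * δ^[t.1] g * δ^[t.2 + p.2] h) := by
      intro p hp
      rw [Finset.HasAntidiagonal.mem_antidiagonal] at hp
      have h1 : i + j + l + 2 * (N : ℤ) - i - 2 * p.1 = j + l + 2 * p.2 := by
        rw [← hp]; push_cast; ring
      have hs : ∀ (c : K) (x : R), δ^[p.1] (c • x) = c • δ^[p.1] x := by
        intro c x
        have : ∀ m : ℕ, δ^[m] (c • x) = c • δ^[m] x := by
          intro m
          induction m with
          | zero => rfl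
          | succ m ih => rw [Function.iterate_succ_apply', ih, Derivation.map_smul,
              Function.iterate_succ_apply']
        exact this p.1
      rw [h1, coeff_monomial_mul_monomial, hs, derivation_iterate_mul, Finset.smul_sum,
        Finset.mul_sum, Finset.smul_sum]
      refine Finset.sum_congr rfl fun t ht => ?_
      rw [Finset.HasAntidiagonal.mem_antidiagonal] at ht
      rw [← ht, ← qpdoCoeff_mul_choose, Function.iterate_add_apply]
      simp only [mul_smul_comm, smul_smul, mul_assoc]
      congr 1; ring
    rw [Finset.sum_congr rfl e1, Finset.sum_congr rfl e2, Finset.sum_sigma', Finset.sum_sigma']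
    refine Finset.sum_nbij'
      (fun x => ⟨(x.1.2 + x.2.1, x.2.2), (x.1.2, x.2.1)⟩)
      (fun x => ⟨(x.2.2 + x.1.2, x.2.1), (x.2.2, x.1.2)⟩) ?_ ?_ ?_ ?_ ?_
    · rintro ⟨⟨a, b⟩, ⟨c, d⟩⟩ hx
      simp only [Finset.mem_sigma, Finset.HasAntidiagonal.mem_antidiagonal] at hx ⊢
      obtain ⟨hx1, hx2⟩ := hx
      exact ⟨by omega, trivial⟩
    · rintro ⟨⟨a, b⟩, ⟨c, d⟩⟩ hx
      simp only [Finset.mem_sigma, Finset.HasAntidiagonal.mem_antidiagonal] at hx ⊢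
      obtain ⟨hx1, hx2⟩ := hx
      exact ⟨by omega, trivial⟩
    · rintro ⟨⟨a, b⟩, ⟨c, d⟩⟩ hx
      simp only [Finset.mem_sigma, Finset.HasAntidiagonal.mem_antidiagonal] at hx ⊢
      obtain ⟨hx1, rfl⟩ := hx
      rfl
    · rintro ⟨⟨a, b⟩, ⟨c, d⟩⟩ hx
      simp only [Finset.mem_sigma, Finset.HasAntidiagonal.mem_antidiagonal] at hx ⊢
      obtain ⟨hx1, rfl⟩ := hx
      rfl
    · rintro ⟨⟨a, b⟩, ⟨c, d⟩⟩ hx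
      rfl
  · push Not at hn
    rw [coeff_mul_monomial (N := M) l h (v1.mono (by omega)),
      coeff_monomial_mul (N := M) i f (v2.mono (by omega)),
      Finset.sum_eq_zero, Finset.sum_eq_zero]
    · intro k _
      rw [coeff_monomial_mul_monomial_of_ne, iterate_zero', mul_zero, smul_zero]
      intro a ha
      exact hn (k + a) (by push_cast; omega)
    · intro k _
      rw [coeff_monomial_mul_monomial_of_ne, zero_mul, smul_zero]
      intro a ha
      exact hn (k + a) (by push_cast; omega)

theorem induction_monomial {P : QPDO δ → Prop} (hadd : ∀ q r, P q → P r → P (q + r))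
    (hmon : ∀ i f, P (monomial i f)) (N : ℤ) (hN : ∀ q, VGe q N → P q) (q : QPDO δ) : P q := by
  have key : ∀ (t : ℕ) (q : QPDO δ), VGe q (N - t) → P q := by
    intro t
    induction t with
    | zero => exact fun q hq => hN q (hq.mono (by simp))
    | succ t ih =>
      intro q hq
      have : q = monomial (N - (t + 1 : ℕ)) (q.coeff (N - (t + 1 : ℕ))) +
          (q - monomial (N - (t + 1 : ℕ)) (q.coeff (N - (t + 1 : ℕ)))) := by abel
      rw [this]
      refine hadd _ _ (hmon _ _) (ih _ fun i hi => ?_)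
      rw [coeff_sub, coeff_monomial]
      split_ifs with h
      · rw [h, sub_self]
      · rw [hq i (by push_cast at *; omega), sub_zero]
  obtain ⟨m, hm⟩ := exists_vGe q
  exact key (N - m).toNat q (hm.mono (by omega))

protected theorem mul_assoc' [CharZero K] (q r s : QPDO δ) : q * r * s = q * (r * s) := by
  ext n
  obtain ⟨a, ha⟩ := exists_vGe q
  obtain ⟨b, hb⟩ := exists_vGe r
  obtain ⟨c, hc⟩ := exists_vGe s
  have high : ∀ (q r s : QPDO δ) (a b c : ℤ), VGe q a → VGe r b → VGe s c → n < a + b + c →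
      (q * r * s).coeff n = (q * (r * s)).coeff n := by
    intro q r s a b c hq hr hs h
    rw [((hq.mul hr).mul hs) n h, (hq.mul (hr.mul hs)) n (by omega)]
  refine induction_monomial (P := fun q => (q * r * s).coeff n = (q * (r * s)).coeff n)
    ?_ ?_ (n - b - c + 1) (fun q hq => high q r s _ b c hq hb hc (by omega)) q
  · intro q q' h h'
    simp only [QPDO.right_distrib', coeff_add, h, h']
  intro i f
  refine induction_monomial (P := fun r => (monomial i f * r * s).coeff n =
    (monomial i f * (r * s)).coeff n) ?_ ?_ (n - i - c + 1)
    (fun r hr => high _ r s i _ c (vGe_monomial i f) hr hc (by omega)) r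
  · intro q q' h h'
    simp only [QPDO.right_distrib', QPDO.left_distrib', coeff_add, h, h']
  intro j g
  refine induction_monomial (P := fun s => (monomial i f * monomial j g * s).coeff n =
    (monomial i f * (monomial j g * s)).coeff n) ?_ ?_ (n - i - j + 1)
    (fun s hs => high _ _ s i j _ (vGe_monomial i f) (vGe_monomial j g) hs (by omega)) s
  · intro q q' h h'
    simp only [QPDO.left_distrib', coeff_add, h, h']
  intro l h
  rw [QPDO.monomial_assoc]

protected theorem one_mul' (q : QPDO δ) : 1 * q = q := by
  ext n
  obtain ⟨a, ha⟩ := exists_vGe q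
  rw [one_def, coeff_monomial_mul (N := (n - a).toNat) 0 1 (ha.mono (by omega)),
    Finset.sum_range_succ', Finset.sum_eq_zero]
  · simp [qpdoCoeff_zero_right]
  · intro k _
    rw [qpdoCoeff_zero_left, zero_smul]

protected theorem mul_one' (q : QPDO δ) : q * 1 = q := by
  ext n
  obtain ⟨a, ha⟩ := exists_vGe q
  rw [one_def, coeff_mul_monomial (N := (n - a).toNat) 0 1 (ha.mono (by omega)),
    Finset.sum_range_succ', Finset.sum_eq_zero]
  · simp [qpdoCoeff_zero_right]
  · intro k _
    rw [Function.iterate_succ_apply, Derivation.map_one_eq_zero, iterate_zero', mul_zero,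
      smul_zero]

noncomputable instance [CharZero K] : Ring (QPDO δ) where
  __ := (inferInstance : AddCommGroup (QPDO δ))
  left_distrib := QPDO.left_distrib'
  right_distrib := QPDO.right_distrib'
  zero_mul q := by
    have h := QPDO.right_distrib' 0 0 q
    rw [add_zero] at h
    exact left_eq_add.mp h
  mul_zero q := by
    have h := QPDO.left_distrib' q 0 0
    rw [add_zero] at h
    exact left_eq_add.mp h
  mul_assoc := QPDO.mul_assoc'
  one_mul := QPDO.one_mul'
  mul_one := QPDO.mul_one'

end QPDO

namespace QPDO

variable {K R : Type*} [Field K] [CommRing R] [Algebra K R] {δ : Derivation K R R}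

theorem monomial_mul_monomial_one (i j : ℤ) (f : R) :
    (monomial i f * monomial j 1 : QPDO δ) = monomial (i + j) f := by
  ext n
  rw [coeff_monomial]
  split_ifs with h
  · have := coeff_monomial_mul_monomial (δ := δ) i j f 1 0
    simp only [Nat.cast_zero, mul_zero, add_zero, ← h] at this
    rw [this, qpdoCoeff_zero_right]
    simp
  · by_cases hn : ∃ a : ℕ, n = i + j + 2 * a
    · obtain ⟨a, rfl⟩ := hn
      rw [coeff_monomial_mul_monomial]
      obtain _ | a := a
      · simp at h
      · rw [Function.iterate_succ_apply, Derivation.map_one_eq_zero, iterate_zero', mul_zero,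
          smul_zero]
    · push Not at hn
      exact coeff_monomial_mul_monomial_of_ne i j f 1 n hn

variable [CharZero K]

variable (δ) in
/-- The inclusion of `R` in `R((y ; δ))₂` as the series of degree zero. -/
noncomputable def ofR : R →+* QPDO δ where
  toFun f := monomial 0 f
  map_one' := rfl
  map_zero' := by ext n; simp [coeff_monomial]
  map_add' f g := by ext n; simp only [coeff_add, coeff_monomial]; split_ifs <;> simp
  map_mul' f g := by
    ext n
    rw [coeff_monomial_mul (N := (n - 0).toNat) 0 f ((vGe_monomial 0 g).mono (by omega)),
      Finset.sum_range_succ', Finset.sum_eq_zero]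
    · simp [qpdoCoeff_zero_right, coeff_monomial]
    · intro k _
      rw [qpdoCoeff_zero_left, zero_smul]

theorem coeff_ofR (f : R) (n : ℤ) : (ofR δ f).coeff n = if n = 0 then f else 0 := rfl

variable (δ) in
/-- The indeterminate `y`, as an invertible element. -/
noncomputable def y : (QPDO δ)ˣ where
  val := monomial 1 1
  inv := monomial (-1) 1
  val_inv := by rw [monomial_mul_monomial_one]; rfl
  inv_val := by rw [monomial_mul_monomial_one]; rfl

/-- `q` is the sum of the family `F` for the `y`-adic topology: up to any given order only
finitely many members of the family contribute, and `q` is their sum coefficientwise. -/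
def IsFormalSum {ι : Type*} (F : ι → QPDO δ) (q : QPDO δ) : Prop :=
  ∀ n : ℤ, {a | ∃ i ≤ n, (F a).coeff i ≠ 0}.Finite ∧ q.coeff n = ∑ᶠ a, (F a).coeff n

theorem exists_solution (F : QPDO δ → QPDO δ) (a b : ℤ) (u : R) (hu : IsUnit u)
    (H : ∀ q r l, VGe q a → VGe r a → a ≤ l → VGe (q - r) l →
      (F q).coeff (l + b) - (F r).coeff (l + b) = u * (q - r).coeff l) (t : QPDO δ) :
    ∃ q, VGe q a ∧ ∀ n, a ≤ n → (F q).coeff (n + b) = t.coeff (n + b) := by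
  obtain ⟨u, rfl⟩ := hu
  let S : (ℕ → R) → QPDO δ := fun g =>
    ofCoeff (fun n => if n < a then 0 else g (n - a).toNat) ⟨a, fun i hi => if_pos hi⟩
  have hSv : ∀ g, VGe (S g) a := fun g i hi => if_pos hi
  have hS : ∀ g (n : ℕ), (S g).coeff (a + n) = g n := by
    intro g n
    change (if _ < _ then _ else _) = _
    rw [if_neg (by omega)]
    congr 1; omega
  let Φ : (ℕ → R) → ℕ → R := fun g n =>
    g n + (↑u⁻¹ : R) * (t.coeff (a + n + b) - (F (S g)).coeff (a + n + b))
  have hΦ : ∀ g g' n, (∀ k < n, g k = g' k) → Φ g n = Φ g' n := by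
    intro g g' n hg
    have h1 := H (S g) (S g') (a + n) (hSv g) (hSv g') (by omega) (by
      intro i hi
      rcases lt_or_ge i a with h | h
      · rw [coeff_sub, hSv g i h, hSv g' i h, sub_zero]
      · obtain ⟨k, rfl⟩ : ∃ k : ℕ, i = a + k := ⟨(i - a).toNat, by omega⟩
        rw [coeff_sub, hS, hS, hg k (by omega), sub_self])
    rw [coeff_sub, hS, hS] at h1
    simp only [Φ]
    have h2 : (↑u⁻¹ : R) * ↑u = 1 := u.inv_mul
    linear_combination (-(↑u⁻¹ : R)) * h1 - (g n - g' n) * h2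
  let G : ℕ → R := fun n => Nat.strongRec (motive := fun _ => R)
    (fun n ih => Φ (fun k => if h : k < n then ih k h else 0) n) n
  have hG : ∀ n, G n = Φ G n := by
    intro n
    have h0 : G n = Φ (fun k => if k < n then G k else 0) n := by
      simp only [G]
      rw [Nat.strongRec_eq]
      simp only [dite_eq_ite]
    rw [h0]
    exact hΦ _ _ _ fun k hk => if_pos hk
  refine ⟨S G, hSv G, fun n hn => ?_⟩
  obtain ⟨k, rfl⟩ : ∃ k : ℕ, n = a + k := ⟨(n - a).toNat, by omega⟩
  have h3 := hG k
  simp only [Φ, left_eq_add, Units.mul_right_eq_zero] at h3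
  exact (sub_eq_zero.mp h3).symm

theorem exists_right_inv {q : QPDO δ} {m : ℤ} (hq : VGe q m) (hu : IsUnit (q.coeff m)) :
    ∃ r, VGe r (-m) ∧ q * r = 1 := by
  obtain ⟨r, hr, h⟩ := exists_solution (δ := δ) (fun r => q * r) (-m) m (q.coeff m) hu (by
    intro r s l _ _ _ h
    rw [← coeff_sub, ← mul_sub, add_comm l m, hq.coeff_mul_eq h]) 1
  refine ⟨r, hr, ?_⟩
  ext n
  rcases lt_or_ge n 0 with hn | hn
  · rw [hq.mul hr n (by omega), one_def, vGe_monomial 0 1 n hn]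
  · have := h (n - m) (by omega)
    rwa [sub_add_cancel] at this

theorem exists_inv {q : QPDO δ} {m : ℤ} (hq : VGe q m) (hu : IsUnit (q.coeff m)) :
    ∃ r, VGe r (-m) ∧ q * r = 1 ∧ r * q = 1 := by
  obtain ⟨r, hr, h⟩ := exists_right_inv hq hu
  have h0 : q.coeff m * r.coeff (-m) = 1 := by
    rw [← hq.coeff_mul_eq hr, h, add_neg_cancel]
    simp [one_def, coeff_monomial]
  obtain ⟨s, _, hs⟩ := exists_right_inv hr (IsUnit.of_mul_eq_one_right _ h0)
  have : s = q := by
    calc s = (q * r) * s := by rw [h, one_mul]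
      _ = q := by rw [mul_assoc, hs, mul_one]
  exact ⟨r, hr, h, this ▸ hs⟩

/-- A series `q = e² y² + ⋯` with `e` invertible has exactly one square root `e y + ⋯`. -/
theorem existsUnique_sqrt (q : QPDO δ) (e : R) (he : IsUnit e) (hq : VGe q 2)
    (hq2 : q.coeff 2 = e ^ 2) :
    ∃! z : QPDO δ, VGe z 1 ∧ z.coeff 1 = e ∧ z ^ 2 = q := by
  have h2 : IsUnit (2 * e) := by
    refine IsUnit.mul ?_ he
    have : IsUnit (algebraMap K R 2) := (IsUnit.mk0 (2 : K) two_ne_zero).map _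
    rwa [map_ofNat] at this
  have hdiff : ∀ (z w : QPDO δ) (l : ℤ), VGe z 1 → VGe w 1 → z.coeff 1 = e → w.coeff 1 = e →
      VGe (z - w) l → (z ^ 2).coeff (l + 1) - (w ^ 2).coeff (l + 1) =
        2 * e * (z - w).coeff l := by
    intro z w l hz hw hze hwe h
    have : z ^ 2 - w ^ 2 = z * (z - w) + (z - w) * w := by noncomm_ring
    rw [← coeff_sub, this, coeff_add, h.coeff_mul_eq hw, add_comm l 1, hz.coeff_mul_eq h, hze, hwe]
    ring
  have hm : ∀ z : QPDO δ, VGe z 2 → VGe (monomial 1 e + z) 1 ∧ (monomial 1 e + z).coeff 1 = e := by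
    intro z hz
    refine ⟨(vGe_monomial 1 e).add (hz.mono (by omega)), ?_⟩
    rw [coeff_add, hz 1 (by omega), coeff_monomial, if_pos rfl, add_zero]
  obtain ⟨z, hz, h⟩ := exists_solution (δ := δ) (fun z => (monomial 1 e + z) ^ 2) 2 1 (2 * e) h2
    (by
      intro z w l hz hw _ h
      have := hdiff (monomial 1 e + z) (monomial 1 e + w) l (hm z hz).1 (hm w hw).1 (hm z hz).2
        (hm w hw).2 (by rwa [add_sub_add_left_eq_sub])
      rwa [add_sub_add_left_eq_sub] at this) q
  refine ⟨monomial 1 e + z, ⟨(hm z hz).1, (hm z hz).2, ?_⟩, ?_⟩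
  · ext n
    rcases lt_trichotomy n 2 with hn | rfl | hn
    · rw [pow_two, (hm z hz).1.mul (hm z hz).1 n (by omega), hq n hn]
    · have := (hm z hz).1.coeff_mul_eq (hm z hz).1
      rw [(hm z hz).2] at this
      rw [pow_two, hq2, pow_two]
      exact this
    · have := h (n - 1) (by omega)
      rwa [sub_add_cancel] at this
  · intro w hw
    have hz2 : (monomial 1 e + z) ^ 2 = q := by
      ext n
      rcases lt_trichotomy n 2 with hn | rfl | hn
      · rw [pow_two, (hm z hz).1.mul (hm z hz).1 n (by omega), hq n hn]
      · have := (hm z hz).1.coeff_mul_eq (hm z hz).1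
        rw [(hm z hz).2] at this
        rw [pow_two, hq2, pow_two]
        exact this
      · have := h (n - 1) (by omega)
        rwa [sub_add_cancel] at this
    have key : ∀ k : ℕ, VGe (w - (monomial 1 e + z)) k := by
      intro k
      induction k with
      | zero =>
        intro i hi
        rw [coeff_sub, hw.1 i (by push_cast at hi; omega),
          (hm z hz).1 i (by push_cast at hi; omega), sub_zero]
      | succ k ih =>
        intro i hi
        rcases lt_or_ge i (k : ℤ) with h' | h'
        · exact ih i h'
        · obtain rfl : i = k := by push_cast at hi; omega
          have := hdiff w (monomial 1 e + z) k hw.1 (hm z hz).1 hw.2.1 (hm z hz).2 ih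
          rw [hw.2.2, hz2, sub_self] at this
          exact (h2.mul_right_eq_zero.mp this.symm)
    rw [← sub_eq_zero]
    ext n
    exact key (n + 1).toNat n (by omega)

theorem vGe_zpow {Y : (QPDO δ)ˣ} (h : VGe (Y : QPDO δ) 1) (h' : VGe (↑Y⁻¹ : QPDO δ) (-1))
    (n : ℤ) : VGe (↑(Y ^ n) : QPDO δ) n := by
  have aux : ∀ (Z : (QPDO δ)ˣ) (a : ℤ), VGe (Z : QPDO δ) a →
      ∀ n : ℕ, VGe (↑(Z ^ n) : QPDO δ) (n * a) := by
    intro Z a hZ n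
    induction n with
    | zero => simpa using! vGe_monomial (δ := δ) 0 1
    | succ n ih =>
      rw [pow_succ, Units.val_mul]
      exact (ih.mul hZ).mono (by push_cast; linarith)
  obtain ⟨k, rfl | rfl⟩ := n.eq_nat_or_neg
  · simpa using aux Y 1 h k
  · simpa using aux Y⁻¹ (-1) h' k

/-- For a ring endomorphism `φ` of `R` and an invertible series `Y` of valuation one, the map
`∑ f_n y^n ↦ ∑ φ(f_n) Y^n` (the sum is taken coefficientwise). -/
noncomputable def subst (φ : R →+* R) (Y : (QPDO δ)ˣ) (h : VGe (Y : QPDO δ) 1)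
    (h' : VGe (↑Y⁻¹ : QPDO δ) (-1)) (q : QPDO δ) : QPDO δ :=
  ofCoeff (fun m => ∑ᶠ n : ℤ, (ofR δ (φ (q.coeff n)) * ((Y ^ n : (QPDO δ)ˣ) : QPDO δ)).coeff m) <| by
    obtain ⟨a, ha⟩ := exists_vGe q
    refine ⟨a, fun m hm => finsum_eq_zero_of_forall_eq_zero fun n => ?_⟩
    rcases lt_or_ge n a with hn | hn
    · rw [ha n hn, map_zero, map_zero, zero_mul, coeff_zero]
    · exact ((vGe_monomial 0 _).mul (vGe_zpow h h' n)) m (by omega)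

theorem isFormalSum_subst (φ : R →+* R) (Y : (QPDO δ)ˣ) (h : VGe (Y : QPDO δ) 1)
    (h' : VGe (↑Y⁻¹ : QPDO δ) (-1)) (q : QPDO δ) :
    IsFormalSum (fun n : ℤ => ofR δ (φ (q.coeff n)) * ((Y ^ n : (QPDO δ)ˣ) : QPDO δ)) (subst φ Y h h' q) := by
  obtain ⟨a, ha⟩ := exists_vGe q
  refine fun m => ⟨(Set.finite_Icc a m).subset ?_, rfl⟩
  rintro n ⟨i, hi, hne⟩
  constructor
  · by_contra hn
    refine hne ?_
    change (ofR δ (φ (q.coeff n)) * ((Y ^ n : (QPDO δ)ˣ) : QPDO δ)).coeff i = 0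
    rw [ha n (by omega), map_zero, map_zero, zero_mul, coeff_zero]
  · by_contra hn
    exact hne (((vGe_monomial 0 _).mul (vGe_zpow h h' n)) i (by omega))

end QPDO

/-! ### Algebras of functions in one variable with a homographic action -/

/-- The filter of subsets of `ℂ` that contain an open set whose complement in `U` is countable. -/
def genericFilter (U : Set ℂ) : Filter ℂ where
  sets := {S | (U \ interior S).Countable}
  univ_sets := by simp
  sets_of_superset {S T} hS hST := hS.mono (Set.sdiff_subset_sdiff_right (interior_mono hST))
  inter_sets {S T} hS hT := by
    simp only [Set.mem_ofPred_eq, interior_inter, Set.sdiff_inter] at *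
    exact hS.union hT

theorem mem_genericFilter {U S : Set ℂ} : S ∈ genericFilter U ↔ (U \ interior S).Countable :=
  Iff.rfl

/-- Functions of one complex variable on `U`, where two functions are identified when they agree on
the complement in `U` of a relatively closed countable subset. For `U` open and connected this
contains the meromorphic functions on `U`. -/
abbrev FunGerm (U : Set ℂ) : Type := Filter.Germ (genericFilter U) ℂ

noncomputable instance (U : Set ℂ) : Algebra ℂ (FunGerm U) :=
  Algebra.ofModule
    (fun r f g => by
      induction f using Filter.Germ.inductionOn with | _ f
      induction g using Filter.Germ.inductionOn with | _ g
      exact congrArg _ (funext fun z => smul_mul_assoc r (f z) (g z)))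
    (fun r f g => by
      induction f using Filter.Germ.inductionOn with | _ f
      induction g using Filter.Germ.inductionOn with | _ g
      exact congrArg _ (funext fun z => mul_smul_comm r (f z) (g z)))

/-- `c z + d` for `γ = (a b; c d)`. -/
def homDenom (γ : Matrix.SpecialLinearGroup (Fin 2) ℂ) (z : ℂ) : ℂ := γ.1 1 0 * z + γ.1 1 1

/-- `(a z + b) / (c z + d)` for `γ = (a b; c d)`. -/
noncomputable def homography (γ : Matrix.SpecialLinearGroup (Fin 2) ℂ) (z : ℂ) : ℂ :=
  (γ.1 0 0 * z + γ.1 0 1) / homDenom γ z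

/-- `R` is an integral domain of functions on the open set `U` of the complex variable `z`, each of
them holomorphic outside a relatively closed countable subset of `U`, on which the group `Γ` acts by
`(f · γ)(z) = f ((a z + b) / (c z + d))`, in which `c z + d` is invertible for all `γ ∈ Γ`, and
which is stable under the derivation `∂_z`. -/
structure IsHomographicAlgebra (U : Set ℂ) (Γ : Subgroup (Matrix.SpecialLinearGroup (Fin 2) ℂ))
    (R : Subalgebra ℂ (FunGerm U)) : Prop where
  isOpen : IsOpen U
  homography_mem : ∀ γ ∈ Γ, ∀ z ∈ U, homDenom γ z ≠ 0 → homography γ z ∈ U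
  isDomain : IsDomain R
  differentiable : ∀ f : ℂ → ℂ, (f : FunGerm U) ∈ R →
    ∀ᶠ z in genericFilter U, DifferentiableAt ℂ f z
  comp_mem : ∀ γ ∈ Γ, ∀ f : ℂ → ℂ, (f : FunGerm U) ∈ R →
    ((fun z => f (homography γ z) : ℂ → ℂ) : FunGerm U) ∈ R
  denom_mem : ∀ γ ∈ Γ, ((fun z => homDenom γ z : ℂ → ℂ) : FunGerm U) ∈ R
  denom_inv_mem : ∀ γ ∈ Γ, ((fun z => (homDenom γ z)⁻¹ : ℂ → ℂ) : FunGerm U) ∈ R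
  deriv_mem : ∀ f : ℂ → ℂ, (f : FunGerm U) ∈ R → ((deriv f : ℂ → ℂ) : FunGerm U) ∈ R

namespace IsHomographicAlgebra

theorem det_eq (γ : Matrix.SpecialLinearGroup (Fin 2) ℂ) :
    γ.1 0 0 * γ.1 1 1 - γ.1 0 1 * γ.1 1 0 = 1 := by
  rw [← Matrix.det_fin_two]; exact γ.2

theorem countable_denom_zero (γ : Matrix.SpecialLinearGroup (Fin 2) ℂ) :
    {z | homDenom γ z = 0}.Countable := by
  refine Set.Subsingleton.countable fun z hz w hw => ?_
  simp only [homDenom, Set.mem_ofPred_eq] at hz hw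
  have hd := det_eq γ
  linear_combination (γ.1 0 0 * w + γ.1 0 1) * hz * (-1) + (γ.1 0 0 * z + γ.1 0 1) * hw - (z - w) * hd

theorem isOpen_denom_ne (γ : Matrix.SpecialLinearGroup (Fin 2) ℂ) :
    IsOpen {z | homDenom γ z ≠ 0} := by
  refine isOpen_ne_fun ?_ continuous_const
  unfold homDenom
  fun_prop

theorem eventually_denom_ne (U : Set ℂ) (γ : Matrix.SpecialLinearGroup (Fin 2) ℂ) :
    ∀ᶠ z in genericFilter U, homDenom γ z ≠ 0 := by
  rw [Filter.Eventually, mem_genericFilter, (isOpen_denom_ne γ).interior_eq]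
  refine (countable_denom_zero γ).mono fun z hz => ?_
  simpa using hz.2

theorem eventually_eventually_nhds {U : Set ℂ} {p : ℂ → Prop}
    (h : ∀ᶠ z in genericFilter U, p z) : ∀ᶠ z in genericFilter U, ∀ᶠ w in nhds z, p w := by
  rw [Filter.Eventually, mem_genericFilter] at h ⊢
  refine h.mono (Set.sdiff_subset_sdiff_right (interior_maximal (fun z hz => ?_) isOpen_interior))
  exact mem_interior_iff_mem_nhds.mp hz

variable {U : Set ℂ} {Γ : Subgroup (Matrix.SpecialLinearGroup (Fin 2) ℂ)}
  {R : Subalgebra ℂ (FunGerm U)}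

theorem tendsto_homography (h : IsHomographicAlgebra U Γ R) (γ : Γ) :
    Filter.Tendsto (homography γ.1) (genericFilter U) (genericFilter U) := by
  intro S hS
  rw [Filter.mem_map, mem_genericFilter]
  rw [mem_genericFilter] at hS
  have h1 : ({z | homDenom γ.1 z ≠ 0} ∩ homography γ.1 ⁻¹' (U \ interior S)).Countable := by
    rw [Set.inter_comm]
    refine Set.Countable.mono ?_
      ((hS.preimage_of_injOn (f := fun z : {z // homDenom γ.1 z ≠ 0} => homography γ.1 z)
        ?_).image Subtype.val)
    · rintro z ⟨hz, hz'⟩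
      exact ⟨⟨z, hz'⟩, hz, rfl⟩
    · rintro ⟨z, hz⟩ _ ⟨w, hw⟩ _ hzw
      have hd := det_eq γ.1
      simp only [homography] at hzw
      rw [div_eq_div_iff hz hw] at hzw
      simp only [homDenom] at hzw
      refine Subtype.ext ?_
      linear_combination hzw - (z - w) * hd
  refine ((countable_denom_zero γ.1).union h1).mono ?_
  rintro z ⟨hzU, hz⟩
  by_cases hd : homDenom γ.1 z = 0
  · exact Or.inl hd
  · refine Or.inr ⟨hd, h.homography_mem γ.1 γ.2 z hzU hd, fun hmem => hz ?_⟩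
    have hc : ContinuousAt (homography γ.1) z := by
      unfold homography homDenom at *
      fun_prop (disch := exact hd)
    rw [mem_interior_iff_mem_nhds] at hmem ⊢
    exact hc hmem

/-- The action `f ↦ f · γ` on `R`, `(f · γ)(z) = f ((a z + b) / (c z + d))`. -/
noncomputable def act (h : IsHomographicAlgebra U Γ R) (γ : Γ) : R →+* R where
  toFun f := ⟨f.1.compTendsto (homography γ.1) (h.tendsto_homography γ), by
    obtain ⟨f, hf⟩ := f
    induction f using Filter.Germ.inductionOn with | _ f
    exact h.comp_mem γ.1 γ.2 f hf⟩
  map_one' := rfl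
  map_zero' := rfl
  map_mul' f g := by
    obtain ⟨f, hf⟩ := f
    obtain ⟨g, hg⟩ := g
    induction f using Filter.Germ.inductionOn with | _ f
    induction g using Filter.Germ.inductionOn with | _ g
    rfl
  map_add' f g := by
    obtain ⟨f, hf⟩ := f
    obtain ⟨g, hg⟩ := g
    induction f using Filter.Germ.inductionOn with | _ f
    induction g using Filter.Germ.inductionOn with | _ g
    rfl

/-- The invertible element `s_γ = c z + d` of `R`. -/
noncomputable def s (h : IsHomographicAlgebra U Γ R) (γ : Γ) : Rˣ where
  val := ⟨_, h.denom_mem γ.1 γ.2⟩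
  inv := ⟨_, h.denom_inv_mem γ.1 γ.2⟩
  val_inv := Subtype.ext <| Filter.Germ.coe_eq.mpr <|
    (eventually_denom_ne U γ.1).mono fun _ hz => mul_inv_cancel₀ hz
  inv_val := Subtype.ext <| Filter.Germ.coe_eq.mpr <|
    (eventually_denom_ne U γ.1).mono fun _ hz => inv_mul_cancel₀ hz

/-- The derivation `∂_z` of `R`. -/
noncomputable def partialZ (h : IsHomographicAlgebra U Γ R) : Derivation ℂ R R :=
  Derivation.mk'
    { toFun := fun f => ⟨f.1.map' deriv (fun _ _ hfg =>
          (eventually_eventually_nhds hfg).mono fun _ hz => Filter.EventuallyEq.deriv_eq hz), by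
        obtain ⟨f, hf⟩ := f
        induction f using Filter.Germ.inductionOn with | _ f
        exact h.deriv_mem f hf⟩
      map_add' := by
        rintro ⟨f, hf⟩ ⟨g, hg⟩
        induction f using Filter.Germ.inductionOn with | _ f
        induction g using Filter.Germ.inductionOn with | _ g
        refine Subtype.ext (Filter.Germ.coe_eq.mpr ?_)
        filter_upwards [h.differentiable f hf, h.differentiable g hg] with z hz hz'
        exact deriv_add hz hz'
      map_smul' := by
        rintro r ⟨f, hf⟩
        induction f using Filter.Germ.inductionOn with | _ f
        refine Subtype.ext (Filter.Germ.coe_eq.mpr ?_)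
        filter_upwards [h.differentiable f hf] with z hz
        exact deriv_const_smul r hz }
    (by
      rintro ⟨f, hf⟩ ⟨g, hg⟩
      induction f using Filter.Germ.inductionOn with | _ f
      induction g using Filter.Germ.inductionOn with | _ g
      refine Subtype.ext (Filter.Germ.coe_eq.mpr ?_)
      filter_upwards [h.differentiable f hf, h.differentiable g hg] with z hz hz'
      refine (deriv_mul hz hz').trans ?_
      change _ = f z * deriv g z + g z * deriv f z
      ring)

/-- The derivation `δ_z = -½ ∂_z` of `R`. -/
noncomputable def delta (h : IsHomographicAlgebra U Γ R) : Derivation ℂ R R :=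
  (-(1 / 2 : ℂ)) • h.partialZ

theorem existsUnique_yAct (h : IsHomographicAlgebra U Γ R) (γ : Γ) :
    ∃! z : QPDO h.delta, QPDO.VGe z 1 ∧ z.coeff 1 = ↑(h.s γ)⁻¹ ∧
      z ^ 2 = (QPDO.y h.delta : QPDO h.delta) ^ 2 * QPDO.ofR h.delta (↑(h.s γ ^ (-2 : ℤ)) : R) := by
  have hy : (QPDO.y h.delta : QPDO h.delta) ^ 2 = QPDO.monomial 2 1 := by
    rw [pow_two]
    exact QPDO.monomial_mul_monomial_one 1 1 1
  have v : QPDO.VGe (QPDO.monomial 2 1 : QPDO h.delta) 2 := QPDO.vGe_monomial 2 1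
  have v' : QPDO.VGe (QPDO.ofR h.delta (↑(h.s γ ^ (-2 : ℤ)) : R)) 0 :=
    QPDO.vGe_monomial 0 _
  refine QPDO.existsUnique_sqrt _ _ (h.s γ)⁻¹.isUnit ?_ ?_ <;> rw [hy]
  · exact v.mul v'
  · refine (v.coeff_mul_eq v').trans ?_
    have h1 : h.s γ ^ (-2 : ℤ) = (h.s γ)⁻¹ ^ 2 := by
      rw [zpow_neg, inv_pow]; rfl
    rw [h1, Units.val_pow_eq_pow_val, QPDO.coeff_ofR, QPDO.coeff_monomial, if_pos rfl, if_pos rfl,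
      one_mul]

/-- `y · γ`: the square root of `x · γ = x (c z + d)⁻²`, where `x = y²`, whose term of minimal
valuation is `(c z + d)⁻¹ y`; here as an element of the ring. -/
noncomputable def yActVal (h : IsHomographicAlgebra U Γ R) (γ : Γ) : QPDO h.delta :=
  (h.existsUnique_yAct γ).choose

theorem yActVal_spec (h : IsHomographicAlgebra U Γ R) (γ : Γ) :
    QPDO.VGe (h.yActVal γ) 1 ∧ (h.yActVal γ).coeff 1 = ↑(h.s γ)⁻¹ ∧
      h.yActVal γ ^ 2 = (QPDO.y h.delta : QPDO h.delta) ^ 2 * QPDO.ofR h.delta (↑(h.s γ ^ (-2 : ℤ)) : R) :=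
  (h.existsUnique_yAct γ).choose_spec.1

theorem exists_inv_yActVal (h : IsHomographicAlgebra U Γ R) (γ : Γ) :
    ∃ r, QPDO.VGe r (-1) ∧ h.yActVal γ * r = 1 ∧ r * h.yActVal γ = 1 :=
  QPDO.exists_inv (h.yActVal_spec γ).1
    (by rw [(h.yActVal_spec γ).2.1]; exact (h.s γ)⁻¹.isUnit)

/-- `y · γ` as an invertible element. -/
noncomputable def yAct (h : IsHomographicAlgebra U Γ R) (γ : Γ) : (QPDO h.delta)ˣ where
  val := h.yActVal γ
  inv := (h.exists_inv_yActVal γ).choose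
  val_inv := (h.exists_inv_yActVal γ).choose_spec.2.1
  inv_val := (h.exists_inv_yActVal γ).choose_spec.2.2

/-- The action of `γ` on `C = R((y ; -½ ∂_z))₂`: `(∑ f_n y^n) · γ = ∑ (f_n · γ) (y · γ)^n`. -/
noncomputable def actC (h : IsHomographicAlgebra U Γ R) (γ : Γ) (q : QPDO h.delta) :
    QPDO h.delta :=
  QPDO.subst (h.act γ) (h.yAct γ) (h.yActVal_spec γ).1 (h.exists_inv_yActVal γ).choose_spec.1 q

end IsHomographicAlgebra

/-- `ω_k(u) = (4^u u!)⁻¹ ∏_{i=0}^{u-1} (k + 2i)(k + 2i + 2)`. -/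
noncomputable def omegaCoeff (k : ℤ) (u : ℕ) : ℂ :=
  1 / (4 ^ u * (u.factorial : ℂ)) *
    ∏ i ∈ Finset.range u, ((k : ℂ) + 2 * (i : ℂ)) * ((k : ℂ) + 2 * (i : ℂ) + 2)

/-! Write s = cz + d, Y = y·γ, and let W_k be the claimed series (`omegaSeries`). The substitution
sends y^k to Y^k, so the claim is W_k = Y^k. Only three facts about γ enter: δ(s) = -c/2, Y² = y²
s⁻², and Y = s⁻¹ y + ⋯.

Since δ(s) is constant, y^i s = s y^i - (ic/2) y^{i+2}, so right multiplication by s is a two-term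
recursion on numerical coefficients (`affineStep`). On normalised products of two rising factorials
of step 2 it turns the parameters (a, a+2) into (a, a), and (a+2, a+2) into (a, a+2). Applied twice
to W_{k+2}, it gives W_{k+2} s² = W_k y², that is W_{k+2} = W_k Y² (`omegaSeries_add_two`). As Y² is
invertible, induction by steps of 2 in both directions leaves only W_0 = 1 and W_1 = Y.

Squaring W_1 directly would need a convolution identity. Instead, W_1 and Y are both shown to solve
the equation sZ - Zs = (c/2) s Z Y² s, which is linear in Z (`commutator_omegaSeries_one` combined
with W_3 = W_1 Y², and `commutator_of_sq_eq`). Their difference starts in some degree m ≥ 2, and its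
lowest coefficient e satisfies (m-1)(c/2)e = 0; hence it vanishes when c ≠ 0. When c = 0, W_1 is
s⁻¹y and the uniqueness of the square root suffices. -/

/-! ### Numerical identities between rising factorials of step 2 -/

open Finset in
/-- The coefficient `(4^n n!)⁻¹ ∏_{i < n} (a + 2i)(b + 2i)`. -/
noncomputable def doubleRisingCoeff (a b : ℂ) (n : ℕ) : ℂ :=
  (∏ i ∈ range n, (a + 2 * (i : ℂ))) * (∏ i ∈ range n, (b + 2 * (i : ℂ))) /
    (4 ^ n * (n.factorial : ℂ))

theorem prod_add_two_mul_succ (a : ℂ) (n : ℕ) :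
    ∏ i ∈ Finset.range (n + 1), (a + 2 * (i : ℂ)) =
      a * ∏ i ∈ Finset.range n, (a + 2 + 2 * (i : ℂ)) := by
  rw [Finset.prod_range_succ']
  simp only [Nat.cast_zero, mul_zero, add_zero, Nat.cast_add, Nat.cast_one]
  rw [mul_comm]
  congr 1
  exact Finset.prod_congr rfl fun i _ => by ring

theorem omegaCoeff_eq (k : ℤ) : omegaCoeff k = doubleRisingCoeff k (k + 2) := by
  ext n
  rw [omegaCoeff, doubleRisingCoeff, Finset.prod_mul_distrib]
  rw [one_div_mul_eq_div]
  congr 2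
  exact Finset.prod_congr rfl fun i _ => by ring

theorem doubleRisingCoeff_zero (a b : ℂ) : doubleRisingCoeff a b 0 = 1 := by
  simp [doubleRisingCoeff]

/-- The effect on the coefficients of multiplying on the right by `c z + d` a series starting in
degree `a`. -/
noncomputable def affineStep (a : ℂ) (f : ℕ → ℂ) : ℕ → ℂ
  | 0 => f 0
  | n + 1 => f (n + 1) - (a + 2 * n) / 2 * f n

/-- With P_n(a) = ∏_{i<n} (a+2i), the two terms over the common denominator share the factor
P_{n+1}(a) P_n(a+2). What remains is (a+2+2n) - 2(n+1) = a, and a P_n(a+2) = P_{n+1}(a). -/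
theorem affineStep_doubleRisingCoeff (a : ℂ) :
    affineStep a (doubleRisingCoeff a (a + 2)) = doubleRisingCoeff a a := by
  ext n
  cases n with
  | zero => simp [affineStep, doubleRisingCoeff_zero]
  | succ n =>
    have hn : (n : ℂ) + 1 ≠ 0 := Nat.cast_add_one_ne_zero n
    have hf : (n.factorial : ℂ) ≠ 0 := by exact_mod_cast n.factorial_ne_zero
    have h := prod_add_two_mul_succ a n
    simp only [affineStep, doubleRisingCoeff, Nat.factorial_succ, Nat.cast_mul, Nat.cast_add,
      Nat.cast_one, pow_succ]
    rw [Finset.prod_range_succ] at h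
    rw [Finset.prod_range_succ, Finset.prod_range_succ]
    field_simp
    linear_combination (-2 * (a + 2 * n) * ∏ i ∈ Finset.range n, (a + 2 * (i : ℂ))) * h

/-- The same cancellation with b = a + 2: the bracket is (b+2n) - 2(n+1) = a, which turns one factor
P_n(b) into P_{n+1}(a). -/
theorem affineStep_doubleRisingCoeff_self (a : ℂ) :
    affineStep (a + 2) (doubleRisingCoeff (a + 2) (a + 2)) = doubleRisingCoeff a (a + 2) := by
  ext n
  cases n with
  | zero => simp [affineStep, doubleRisingCoeff_zero]
  | succ n =>
    have hn : (n : ℂ) + 1 ≠ 0 := Nat.cast_add_one_ne_zero n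
    have hf : (n.factorial : ℂ) ≠ 0 := by exact_mod_cast n.factorial_ne_zero
    simp only [affineStep, doubleRisingCoeff, Nat.factorial_succ, Nat.cast_mul, Nat.cast_add,
      Nat.cast_one, pow_succ]
    rw [prod_add_two_mul_succ a n, Finset.prod_range_succ]
    field_simp
    ring

/-- The factor 1 + 2n extends 1·3⋯(2n-1) to 3·5⋯(2n+1). It is the weight that the commutator with s
puts on the coefficients of W_1. -/
theorem doubleRisingCoeff_one_three (n : ℕ) :
    (1 + 2 * n) * doubleRisingCoeff 1 3 n = doubleRisingCoeff 3 3 n := by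
  have h := prod_add_two_mul_succ 1 n
  rw [Finset.prod_range_succ] at h
  norm_num at h
  rw [doubleRisingCoeff, doubleRisingCoeff, ← h]
  ring

/-! ### Series in one parity class of exponents, and multiplication by elements of R -/

namespace QPDO

section General

variable {K R : Type*} [Field K] [CommRing R] [Algebra K R] {δ : Derivation K R R}

/-- The series `∑_{n ≥ 0} f n y^{k + 2n}`. -/
noncomputable def evenSeries (k : ℤ) (f : ℕ → R) : QPDO δ :=
  ofCoeff (fun i => if k ≤ i ∧ (i - k) % 2 = 0 then f ((i - k) / 2).toNat else 0)
    ⟨k, fun i hi => if_neg (by omega)⟩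

theorem coeff_evenSeries (k : ℤ) (f : ℕ → R) (n : ℕ) :
    (evenSeries k f : QPDO δ).coeff (k + 2 * n) = f n := by
  change (if _ then _ else _) = _
  rw [if_pos (by omega)]
  congr 1; omega

theorem coeff_evenSeries_of_ne (k : ℤ) (f : ℕ → R) (i : ℤ) (h : ∀ n : ℕ, i ≠ k + 2 * n) :
    (evenSeries k f : QPDO δ).coeff i = 0 := by
  refine if_neg fun h' => h ((i - k) / 2).toNat ?_
  omega

theorem vGe_evenSeries (k : ℤ) (f : ℕ → R) : VGe (evenSeries k f : QPDO δ) k :=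
  fun i hi => coeff_evenSeries_of_ne k f i fun n => by omega

theorem eq_evenSeries_iff (q : QPDO δ) (k : ℤ) (f : ℕ → R) :
    q = evenSeries k f ↔
      (∀ n : ℕ, q.coeff (k + 2 * n) = f n) ∧ ∀ i, (∀ n : ℕ, i ≠ k + 2 * n) → q.coeff i = 0 := by
  refine ⟨?_, fun ⟨h1, h2⟩ => ?_⟩
  · rintro rfl
    exact ⟨coeff_evenSeries k f, coeff_evenSeries_of_ne k f⟩
  · ext i
    by_cases hi : ∃ n : ℕ, i = k + 2 * n
    · obtain ⟨n, rfl⟩ := hi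
      rw [h1, coeff_evenSeries]
    · push Not at hi
      rw [h2 i hi, coeff_evenSeries_of_ne k f i hi]

theorem coeff_mul_monomial_one (q : QPDO δ) (l n : ℤ) :
    (q * monomial l 1).coeff n = q.coeff (n - l) := by
  obtain ⟨a, ha⟩ := exists_vGe q
  rw [coeff_mul_monomial (N := (n - l - a).toNat) l 1 (ha.mono (by omega)),
    Finset.sum_range_succ', Finset.sum_eq_zero]
  · simp [qpdoCoeff_zero_right]
  · intro k _
    rw [Function.iterate_succ_apply, Derivation.map_one_eq_zero, iterate_zero', mul_zero,
      smul_zero]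

variable [CharZero K]

theorem coeff_ofR_mul (f : R) (q : QPDO δ) (n : ℤ) : (ofR δ f * q).coeff n = f * q.coeff n := by
  obtain ⟨a, ha⟩ := exists_vGe q
  change (monomial 0 f * q).coeff n = _
  rw [coeff_monomial_mul (N := (n - a).toNat) 0 f (ha.mono (by omega)),
    Finset.sum_range_succ', Finset.sum_eq_zero]
  · simp [qpdoCoeff_zero_right]
  · intro k _
    rw [qpdoCoeff_zero_left, zero_smul]

/-- Right multiplication by an element of `R` whose second derivative vanishes. -/
theorem coeff_mul_ofR (q : QPDO δ) {g : R} (hg : δ (δ g) = 0) (n : ℤ) :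
    (q * ofR δ g).coeff n =
      q.coeff n * g + ((n - 2 : ℤ) : K) • (q.coeff (n - 2) * δ g) := by
  obtain ⟨a, ha⟩ := exists_vGe q
  change (q * monomial 0 g).coeff n = _
  -- The extra 1 guarantees that the sum contains both terms j = 0 and j = 1, which are split off;
  -- all later ones involve δ²(g) = 0.
  rw [coeff_mul_monomial (N := (n - a).toNat + 1) 0 g (ha.mono (by omega)),
    Finset.sum_range_succ', Finset.sum_range_succ', Finset.sum_eq_zero]
  · simp [qpdoCoeff, add_comm]
  · intro k _
    rw [Function.iterate_succ_apply, Function.iterate_succ_apply, hg, iterate_zero', mul_zero,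
      smul_zero]

/-- Makes the complex scalars central, and also s⁻¹ when c = 0. -/
theorem ofR_mul_eq_mul_ofR (q : QPDO δ) {g : R} (hg : δ g = 0) : ofR δ g * q = q * ofR δ g := by
  ext n
  rw [coeff_ofR_mul, coeff_mul_ofR q (by rw [hg, map_zero]), hg, mul_zero, smul_zero, add_zero,
    mul_comm]

theorem y_zpow (n : ℤ) : ((y δ ^ n : (QPDO δ)ˣ) : QPDO δ) = monomial n 1 := by
  induction n using Int.induction_on with
  | zero => rfl
  | succ n ih =>
    rw [zpow_add_one, Units.val_mul, ih]
    exact monomial_mul_monomial_one _ _ _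
  | pred n ih =>
    rw [zpow_sub_one, Units.val_mul, ih]
    exact monomial_mul_monomial_one _ _ _

theorem ofR_mul_y_zpow (f : R) (n : ℤ) :
    ofR δ f * ((y δ ^ n : (QPDO δ)ˣ) : QPDO δ) = monomial n f := by
  rw [y_zpow]
  refine (monomial_mul_monomial_one 0 n f).trans ?_
  rw [zero_add]

theorem isFormalSum_evenSeries (k : ℤ) (f : ℕ → R) :
    IsFormalSum (fun u : ℕ => ofR δ (f u) * ((y δ ^ (2 * (u : ℤ) + k) : (QPDO δ)ˣ) : QPDO δ))
      (evenSeries k f) := by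
  intro n
  simp only [ofR_mul_y_zpow]
  constructor
  · refine (Set.finite_Iic (n - k).toNat).subset ?_
    rintro u ⟨i, hi, hne⟩
    rw [coeff_monomial] at hne
    have : i = 2 * (u : ℤ) + k := by by_contra h; exact hne (if_neg h)
    rw [Set.mem_Iic]
    omega
  · by_cases hn : ∃ u : ℕ, n = k + 2 * u
    · obtain ⟨u, rfl⟩ := hn
      rw [coeff_evenSeries, finsum_eq_single _ u, coeff_monomial, if_pos (by ring)]
      intro v hv
      rw [coeff_monomial, if_neg (by omega)]
    · push Not at hn
      rw [coeff_evenSeries_of_ne k f n hn, finsum_eq_zero_of_forall_eq_zero]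
      intro v
      rw [coeff_monomial, if_neg]
      intro h
      exact hn v (by omega)

theorem subst_y_zpow (φ : R →+* R) (Y : (QPDO δ)ˣ) (h : VGe (Y : QPDO δ) 1)
    (h' : VGe (↑Y⁻¹ : QPDO δ) (-1)) (k : ℤ) :
    subst φ Y h h' ((y δ ^ k : (QPDO δ)ˣ) : QPDO δ) = ((Y ^ k : (QPDO δ)ˣ) : QPDO δ) := by
  ext m
  rw [(isFormalSum_subst φ Y h h' _ m).2, finsum_eq_single _ k]
  · simp only [y_zpow]
    rw [coeff_monomial, if_pos rfl, map_one, map_one, one_mul]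
  · intro n hn
    simp only [y_zpow]
    rw [coeff_monomial, if_neg hn, map_zero, map_zero, zero_mul, coeff_zero]

end General

end QPDO

/-! ### Series with coefficients built from an invertible s with constant derivative -/

namespace QPDO

/-- The lowest-term argument: a homogeneous linear equation that forces the lowest coefficient to
vanish raises the valuation indefinitely. -/
theorem eq_zero_of_forall_vGe {K R : Type*} [Field K] [CommRing R] [Algebra K R]
    {δ : Derivation K R R} {q : QPDO δ} {a : ℤ} (ha : VGe q a)
    (h : ∀ m, a ≤ m → VGe q m → q.coeff m = 0) : q = 0 := by
  have key : ∀ n : ℕ, VGe q (a + n) := by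
    intro n
    induction n with
    | zero => simpa using ha
    | succ n ih =>
      intro i hi
      rcases lt_or_ge i (a + n) with h' | h'
      · exact ih i h'
      · obtain rfl : i = a + n := by push_cast at hi; omega
        exact h _ (by omega) ih
  ext n
  exact key (n - a + 1).toNat n (by omega)

section Affine

variable {R : Type*} [CommRing R] [Algebra ℂ R] {δ : Derivation ℂ R R}

/-- The series `∑_n f(n) s^m (c / s)^n y^{k + 2n}`. -/
noncomputable def affineSeries (s : Rˣ) (c : ℂ) (k m : ℤ) (f : ℕ → ℂ) : QPDO δ :=
  evenSeries k fun n => f n • ((↑(s ^ m) : R) * (algebraMap ℂ R c * (↑s⁻¹ : R)) ^ n)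

variable {s : Rˣ} {c : ℂ}

theorem affineSeries_mul_monomial_one (k m l : ℤ) (f : ℕ → ℂ) :
    (affineSeries s c k m f * monomial l 1 : QPDO δ) = affineSeries s c (k + l) m f := by
  refine (eq_evenSeries_iff _ _ _).mpr ⟨fun n => ?_, fun i hi => ?_⟩
  · rw [coeff_mul_monomial_one, show k + l + 2 * (n : ℤ) - l = k + 2 * n by ring]
    exact coeff_evenSeries _ _ _
  · rw [coeff_mul_monomial_one]
    exact coeff_evenSeries_of_ne _ _ _ fun n hn => hi n (by omega)

theorem ofR_mul_affineSeries (k m : ℤ) (f : ℕ → ℂ) :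
    (ofR δ (s : R) * affineSeries s c k m f : QPDO δ) = affineSeries s c k (m + 1) f := by
  refine (eq_evenSeries_iff _ _ _).mpr ⟨fun n => ?_, fun i hi => ?_⟩
  · rw [coeff_ofR_mul, affineSeries, coeff_evenSeries, zpow_add_one, Units.val_mul,
      mul_smul_comm]
    congr 1; ring
  · rw [coeff_ofR_mul, affineSeries, coeff_evenSeries_of_ne _ _ _ hi, mul_zero]

/-- The relation y^i s = s y^i - (ic/2) y^{i+2} feeds the degree i = k + 2n term into the next one.
The factor c so produced equals s·(c/s), so both contributions carry s^{m+1} (c/s)^{n+1} and only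
the numerical coefficients change. -/
theorem affineSeries_mul_ofR (hs : δ (s : R) = algebraMap ℂ R (-(c / 2))) (k m : ℤ) (f : ℕ → ℂ) :
    (affineSeries s c k m f * ofR δ (s : R) : QPDO δ) =
      affineSeries s c k (m + 1) (affineStep k f) := by
  have hs2 : δ (δ (s : R)) = 0 := by rw [hs, Derivation.map_algebraMap]
  have hss : (s : R) * (↑s⁻¹ : R) = 1 := s.mul_inv
  refine (eq_evenSeries_iff _ _ _).mpr ⟨fun n => ?_, fun i hi => ?_⟩
  · rw [coeff_mul_ofR _ hs2, hs, zpow_add_one, Units.val_mul]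
    cases n with
    | zero =>
      rw [affineSeries, coeff_evenSeries, coeff_evenSeries_of_ne _ _ _ (by omega)]
      simp [affineStep]
    | succ n =>
      rw [affineSeries, coeff_evenSeries,
        show k + 2 * ((n + 1 : ℕ) : ℤ) - 2 = k + 2 * n by push_cast; ring, coeff_evenSeries]
      simp only [affineStep, Algebra.smul_def, map_sub, map_mul, map_neg, map_ofNat,
        Int.cast_add, Int.cast_mul, Int.cast_natCast, Int.cast_ofNat, map_add, map_intCast,
        map_natCast, pow_succ]
      have e1 : algebraMap ℂ R (c / 2) = algebraMap ℂ R (1 / 2) * algebraMap ℂ R c := by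
        rw [← map_mul]; congr 1; ring
      have e2 : algebraMap ℂ R (((k : ℂ) + 2 * n) / 2) =
          algebraMap ℂ R (1 / 2) * ((k : R) + 2 * n) := by
        rw [← map_intCast (algebraMap ℂ R), ← map_natCast (algebraMap ℂ R),
          ← map_ofNat (algebraMap ℂ R), ← map_mul, ← map_add, ← map_mul]
        congr 1; ring
      rw [e1, e2]
      linear_combination (algebraMap ℂ R (1 / 2) * ((k : R) + 2 * n) * algebraMap ℂ R (f n) *
        (↑(s ^ m) : R) * (algebraMap ℂ R c * (↑s⁻¹ : R)) ^ n * algebraMap ℂ R c) * hss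
  · rw [coeff_mul_ofR _ hs2, affineSeries, coeff_evenSeries_of_ne _ _ _ hi,
      coeff_evenSeries_of_ne _ _ _ fun n hn => hi (n + 1) (by push_cast; omega)]
    simp

/-- The candidate for the `k`-th power of the transformed indeterminate. -/
noncomputable abbrev omegaSeries (s : Rˣ) (c : ℂ) (k : ℤ) : QPDO δ :=
  affineSeries s c k (-k) (omegaCoeff k)

/-! ### The recursion relating the powers k and k + 2 -/

/-- Half of the recursion. The symmetric coefficients reached here are also, for k = 1, those in the
commutator of s with W_1. -/
theorem omegaSeries_add_two_mul_ofR (hs : δ (s : R) = algebraMap ℂ R (-(c / 2))) (k : ℤ) :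
    (omegaSeries s c (k + 2) * ofR δ (s : R) : QPDO δ) =
      affineSeries s c (k + 2) (-(k + 2) + 1) (doubleRisingCoeff (k + 2) (k + 2)) := by
  rw [affineSeries_mul_ofR hs, omegaCoeff_eq]
  push_cast
  rw [affineStep_doubleRisingCoeff]

theorem omegaSeries_add_two_mul_ofR_mul_ofR (hs : δ (s : R) = algebraMap ℂ R (-(c / 2)))
    (k : ℤ) :
    (omegaSeries s c (k + 2) * ofR δ (s : R) * ofR δ (s : R) : QPDO δ) =
      omegaSeries s c k * monomial 2 1 := by
  rw [omegaSeries_add_two_mul_ofR hs, affineSeries_mul_ofR hs, affineSeries_mul_monomial_one,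
    omegaCoeff_eq]
  push_cast
  rw [affineStep_doubleRisingCoeff_self]
  congr 1; ring

theorem omegaSeries_zero : (omegaSeries s c 0 : QPDO δ) = 1 := by
  symm
  refine (eq_evenSeries_iff _ _ _).mpr ⟨fun n => ?_, fun i hi => ?_⟩
  · rw [one_def, coeff_monomial]
    cases n with
    | zero => simp [omegaCoeff]
    | succ n =>
      rw [if_neg (by push_cast; omega), omegaCoeff, Finset.prod_range_succ']
      simp
  · rw [one_def, coeff_monomial, if_neg]
    intro h
    exact hi 0 (by simpa using h)

/-! ### Identification of the first power through a commutator equation -/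

/-- In degree 3 + 2n the commutator has coefficient ((1+2n)/2) ω_1(n), up to powers of s and c. This
is half the symmetric coefficient with parameters (3, 3), which is exactly what W_3 s carries. -/
theorem commutator_omegaSeries_one (hs : δ (s : R) = algebraMap ℂ R (-(c / 2))) :
    (ofR δ (s : R) * omegaSeries s c 1 - omegaSeries s c 1 * ofR δ (s : R) : QPDO δ) =
      ofR δ (algebraMap ℂ R (c / 2)) *
        (ofR δ (s : R) * omegaSeries s c 3 * ofR δ (s : R)) := by
  have h3 := omegaSeries_add_two_mul_ofR hs 1
  rw [mul_assoc (ofR δ (s : R)), show (3 : ℤ) = 1 + 2 by norm_num, h3, ofR_mul_affineSeries,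
    ofR_mul_affineSeries, affineSeries_mul_ofR hs]
  have hss : (s : R) * (↑s⁻¹ : R) = 1 := s.mul_inv
  ext i
  rw [coeff_ofR_mul, coeff_sub]
  simp only [affineSeries]
  by_cases hi : ∃ n : ℕ, i = 1 + 2 * n
  · obtain ⟨n, rfl⟩ := hi
    rw [coeff_evenSeries, coeff_evenSeries, ← sub_smul]
    cases n with
    | zero =>
      rw [coeff_evenSeries_of_ne _ _ _ (by omega)]
      simp [affineStep]
    | succ n =>
      rw [show 1 + 2 * ((n + 1 : ℕ) : ℤ) = 1 + 2 + 2 * n by push_cast; ring, coeff_evenSeries]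
      have e := doubleRisingCoeff_one_three n
      have e' : omegaCoeff 1 = doubleRisingCoeff 1 3 := by
        rw [omegaCoeff_eq]; norm_num
      have e3 : ((1 : ℤ) : ℂ) + 2 = 3 := by norm_num
      have e4 : omegaCoeff 1 (n + 1) - affineStep ((1 : ℤ) : ℂ) (omegaCoeff 1) (n + 1) =
          1 / 2 * doubleRisingCoeff 3 3 n := by
        rw [e', ← e, affineStep]; push_cast; ring
      have e5 : algebraMap ℂ R (c / 2) = algebraMap ℂ R (1 / 2) * algebraMap ℂ R c := by
        rw [← map_mul]; congr 1; ring
      -- Exhibits one more factor s than on the right-hand side, to cancel the s⁻¹ of the extra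
      -- factor c/s.
      have e6 : (-1 + 1 : ℤ) = -(1 + 2) + 1 + 1 + 1 := by norm_num
      rw [e4, e3, e6, zpow_add_one _ (-(1 + 2) + 1 + 1), Units.val_mul, e5]
      simp only [Algebra.smul_def, map_mul, pow_succ]
      linear_combination (algebraMap ℂ R (1 / 2) * algebraMap ℂ R (doubleRisingCoeff 3 3 n) *
        (↑(s ^ (-(1 + 2 : ℤ) + 1 + 1)) : R) * algebraMap ℂ R c *
        (algebraMap ℂ R c * (↑s⁻¹ : R)) ^ n) * hss
  · push Not at hi
    rw [coeff_evenSeries_of_ne _ _ _ hi, coeff_evenSeries_of_ne _ _ _ hi,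
      coeff_evenSeries_of_ne _ _ _ fun n hn => hi (n + 1) (by push_cast; omega)]
    simp

theorem omegaSeries_add_two (hs : δ (s : R) = algebraMap ℂ R (-(c / 2))) (k : ℤ) :
    (omegaSeries s c (k + 2) : QPDO δ) =
      omegaSeries s c k * (monomial 2 1 * ofR δ (↑(s ^ (-2 : ℤ)) : R)) := by
  have h1 : (s : R) * ((s : R) * (↑(s ^ (-2 : ℤ)) : R)) = 1 := by
    rw [← mul_assoc, ← pow_two, ← Units.val_pow_eq_pow_val, ← Units.val_mul, ← zpow_natCast,
      ← zpow_add]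
    simp
  rw [← mul_assoc, ← omegaSeries_add_two_mul_ofR_mul_ofR hs, mul_assoc, mul_assoc, ← map_mul,
    ← map_mul, h1, map_one, mul_one]

/-- If `Y² = y² s⁻²`, then `Y` satisfies the commutation relation of a square root of the
inverse of the derivation dual to `s⁻¹`. -/
theorem commutator_of_sq_eq (hs : δ (s : R) = algebraMap ℂ R (-(c / 2))) {Y : QPDO δ}
    (hv : VGe Y 1) (h1 : Y.coeff 1 = ↑s⁻¹)
    (h2 : Y ^ 2 = monomial 2 1 * ofR δ (↑(s ^ (-2 : ℤ)) : R)) :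
    ofR δ (s : R) * Y - Y * ofR δ (s : R) =
      ofR δ (algebraMap ℂ R (c / 2)) * (ofR δ (s : R) * (Y * Y ^ 2) * ofR δ (s : R)) := by
  obtain ⟨S, hS⟩ : ∃ S, S = ofR δ (s : R) := ⟨_, rfl⟩
  obtain ⟨T, hT⟩ : ∃ T, T = ofR δ (↑s⁻¹ : R) := ⟨_, rfl⟩
  obtain ⟨C, hC⟩ : ∃ C, C = ofR δ (algebraMap ℂ R (c / 2)) := ⟨_, rfl⟩
  obtain ⟨x, hx⟩ : ∃ x : QPDO δ, x = monomial 2 1 := ⟨_, rfl⟩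
  obtain ⟨D, hD⟩ : ∃ D : QPDO δ, D = monomial (-2) 1 := ⟨_, rfl⟩
  have hST : S * T = 1 := by rw [hS, hT, ← map_mul, Units.mul_inv, map_one]
  have hTS : T * S = 1 := by rw [hS, hT, ← map_mul, Units.inv_mul, map_one]
  have hxD : x * D = 1 := by rw [hx, hD, monomial_mul_monomial_one]; rfl
  have hDx : D * x = 1 := by rw [hx, hD, monomial_mul_monomial_one]; rfl
  have hCc : ∀ q, C * q = q * C := fun q => by
    rw [hC]; exact ofR_mul_eq_mul_ofR q (Derivation.map_algebraMap _ _)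
  -- The element y⁻² brackets with s as the derivation -2δ, and -2δ(s) = c = 2C.
  have hDS : D * S = S * D + 2 * C := by
    have e : δ (δ (s : R)) = 0 := by rw [hs, Derivation.map_algebraMap]
    ext n
    rw [hD, hS, coeff_mul_ofR _ e, coeff_add, coeff_ofR_mul, two_mul, coeff_add, hC, coeff_ofR,
      coeff_monomial, coeff_monomial, hs, map_neg]
    by_cases h0 : n = 0
    · subst h0
      rw [show ((0 - 2 : ℤ) : ℂ) = -2 by norm_num, Algebra.smul_def, map_neg, map_ofNat]
      simp
      ring
    · rw [if_neg (c := n - 2 = -2) (by omega), if_neg h0]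
      split_ifs <;> simp
  have hY : Y * Y = x * (T * T) := by
    rw [← pow_two, h2, hx, hT, ← map_mul, zpow_neg, ← Units.val_mul, ← pow_two, inv_pow]
    rfl
  -- Passing to inverses twice, from s to T = s⁻¹ and from y⁻² to x = y², turns the bracket [y⁻², s]
  -- into [x, T] = 2C x T² x. Right multiplication by T² then gives [Y², T] = 2C Y⁴.
  have hTx : Y * Y * T - T * (Y * Y) = 2 * C * (Y * Y) * (Y * Y) := by
    have e1 : T * D = D * T + 2 * (C * (T * T)) := by
      calc T * D = T * D * (S * T) := by rw [hST, mul_one]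
        _ = T * (D * S) * T := by noncomm_ring
        _ = (T * S) * (D * T) + 2 * (T * C * T) := by rw [hDS]; noncomm_ring
        _ = _ := by rw [hTS, ← hCc T, one_mul, mul_assoc C]
    have e2 : x * T = T * x + 2 * (C * (x * (T * T) * x)) := by
      calc x * T = x * T * (D * x) := by rw [hDx, mul_one]
        _ = x * (T * D) * x := by noncomm_ring
        _ = (x * D) * (T * x) + 2 * (x * C * (T * T) * x) := by rw [e1]; noncomm_ring
        _ = _ := by rw [hxD, ← hCc x, one_mul]; noncomm_ring
    rw [hY]
    calc x * (T * T) * T - T * (x * (T * T)) = (x * T) * (T * T) - T * x * (T * T) := by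
          noncomm_ring
      _ = _ := by rw [e2]; noncomm_ring
  have hB : Y * T - T * Y - C * (Y * (Y * Y)) = 0 := by
    obtain ⟨B, hB⟩ : ∃ B, B = Y * T - T * Y - C * (Y * (Y * Y)) := ⟨_, rfl⟩
    -- A square root is taken of the relation for Y²: [Y², T] = Y[Y, T] + [Y, T]Y, so the defect B
    -- of [Y, T] = C Y³ anticommutes with Y. Its lowest coefficient is then killed by the unit 2s⁻¹,
    -- whence B = 0.
    have hYB : Y * B + B * Y = 0 := by
      calc Y * B + B * Y = (Y * Y * T - T * (Y * Y)) - Y * C * (Y * (Y * Y)) -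
            C * (Y * (Y * Y) * Y) := by rw [hB]; noncomm_ring
        _ = 0 := by rw [hTx, ← hCc Y]; noncomm_ring
    rw [← hB]
    obtain ⟨m, hm⟩ := exists_vGe B
    refine eq_zero_of_forall_vGe hm fun l _ hl => ?_
    have h := congrArg (fun q => coeff q (l + 1)) hYB
    simp only [coeff_add, coeff_zero] at h
    rw [hl.coeff_mul_eq hv, add_comm l 1, hv.coeff_mul_eq hl, h1] at h
    have h2R : IsUnit (algebraMap ℂ R 2) := (IsUnit.mk0 (2 : ℂ) two_ne_zero).map _
    rw [map_ofNat] at h2R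
    refine (h2R.mul s⁻¹.isUnit).mul_right_eq_zero.mp ?_
    linear_combination h
  rw [← hS, ← hC]
  -- Multiplying [Y, T] = C Y³ by s on both sides gives sY - Ys.
  calc S * Y - Y * S = S * Y * (T * S) - (S * T) * (Y * S) := by
        rw [hST, hTS, mul_one, one_mul]
    _ = S * (Y * T - T * Y - C * (Y * (Y * Y))) * S + S * C * (Y * (Y * Y)) * S := by
        noncomm_ring
    _ = _ := by rw [hB, ← hCc S]; noncomm_ring

/-- Once W_3 is replaced by W_1 Y², the commutator equation is linear, with Y² as a fixed
coefficient. Its solutions are determined by their degree 1 term, because the lowest-degree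
comparison degenerates only for m = 1. -/
theorem omegaSeries_one_eq_of_ne_zero [IsDomain R] (hs : δ (s : R) = algebraMap ℂ R (-(c / 2)))
    (hc : c ≠ 0) {Y : QPDO δ} (hv : VGe Y 1) (h1 : Y.coeff 1 = ↑s⁻¹)
    (h2 : Y ^ 2 = monomial 2 1 * ofR δ (↑(s ^ (-2 : ℤ)) : R)) :
    (omegaSeries s c 1 : QPDO δ) = Y := by
  have hs2 : δ (δ (s : R)) = 0 := by rw [hs, Derivation.map_algebraMap]
  have hW := commutator_omegaSeries_one (c := c) (δ := δ) hs
  have h3 := omegaSeries_add_two (c := c) (δ := δ) hs 1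
  rw [show (1 + 2 : ℤ) = 3 by norm_num, ← h2] at h3
  rw [h3] at hW
  have hY := commutator_of_sq_eq hs hv h1 h2
  obtain ⟨E, hE⟩ : ∃ E, E = omegaSeries s c 1 - Y := ⟨_, rfl⟩
  have hEc : ofR δ (s : R) * E - E * ofR δ (s : R) =
      ofR δ (algebraMap ℂ R (c / 2)) * (ofR δ (s : R) * (E * Y ^ 2) * ofR δ (s : R)) := by
    have h := congrArg₂ (· - ·) hW hY
    rw [← mul_sub, ← sub_mul, ← mul_sub, ← sub_mul, ← hE] at h
    rw [← h, hE]
    noncomm_ring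
  -- Agreement of the two leading coefficients s⁻¹ excludes the resonant degree m = 1.
  have hE2 : VGe E 2 := by
    have v : VGe (omegaSeries s c 1 : QPDO δ) 1 := vGe_evenSeries _ _
    intro i hi
    rcases lt_or_ge i 1 with h | h
    · rw [hE, coeff_sub, v i h, hv i h, sub_zero]
    · obtain rfl : i = 1 := by omega
      have : (omegaSeries s c 1 : QPDO δ).coeff 1 = ↑s⁻¹ := by
        refine (coeff_evenSeries 1 _ 0).trans ?_
        simp [omegaCoeff]
      rw [hE, coeff_sub, this, h1, sub_self]
  have hv2 : VGe (Y ^ 2) 2 := by rw [pow_two]; exact hv.mul hv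
  have hc2 : (Y ^ 2).coeff 2 = ↑s⁻¹ * ↑s⁻¹ := by
    rw [pow_two, ← h1]; exact hv.coeff_mul_eq hv
  have hss : (s : R) * (↑s⁻¹ : R) = 1 := s.mul_inv
  rw [← sub_eq_zero, ← hE]
  refine eq_zero_of_forall_vGe hE2 fun m hm hEm => ?_
  have h := congrArg (fun q => coeff q (m + 2)) hEc
  have hz : VGe (ofR δ (s : R)) 0 := vGe_monomial 0 _
  -- The two factors s cancel the leading coefficient s⁻² of Y².
  have hr : (ofR δ (s : R) * (E * Y ^ 2) * ofR δ (s : R)).coeff (m + 2) = E.coeff m := by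
    rw [mul_assoc, coeff_ofR_mul, ← add_zero (m + 2), (hEm.mul hv2).coeff_mul_eq hz,
      hEm.coeff_mul_eq hv2, hc2, coeff_ofR, if_pos rfl]
    linear_combination (E.coeff m * (s * ↑s⁻¹ + 1)) * hss
  simp only [coeff_sub] at h
  rw [coeff_ofR_mul, coeff_mul_ofR _ hs2, coeff_ofR_mul, hr, add_sub_cancel_right, hs,
    Algebra.smul_def, map_neg] at h
  -- In degree m + 2 the unknown coefficient of E drops out of the commutator, leaving m(c/2)e on
  -- the left and (c/2)e on the right.
  have h' : algebraMap ℂ R (((m : ℂ) - 1) * (c / 2)) * E.coeff m = 0 := by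
    rw [map_mul, map_sub, map_one]
    linear_combination h
  refine (mul_eq_zero.mp h').resolve_left ?_
  rw [map_eq_zero_iff _ (algebraMap ℂ R).injective]
  refine mul_ne_zero (sub_ne_zero.mpr ?_) (div_ne_zero hc two_ne_zero)
  exact_mod_cast (by omega : m ≠ 1)

theorem omegaSeries_one_eq [IsDomain R] (hs : δ (s : R) = algebraMap ℂ R (-(c / 2)))
    {Y : QPDO δ} (hv : VGe Y 1) (h1 : Y.coeff 1 = ↑s⁻¹)
    (h2 : Y ^ 2 = monomial 2 1 * ofR δ (↑(s ^ (-2 : ℤ)) : R)) :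
    (omegaSeries s c 1 : QPDO δ) = Y := by
  by_cases hc : c = 0
  swap
  · exact omegaSeries_one_eq_of_ne_zero hs hc hv h1 h2
  subst hc
  -- For c = 0 the commutator equation is vacuous. But now s⁻¹ commutes with every series and W_1 =
  -- s⁻¹y, so its square is visibly y² s⁻².
  have hs0 : δ (s : R) = 0 := by rw [hs]; simp
  have hW : (omegaSeries s 0 1 : QPDO δ) = ofR δ (↑s⁻¹ : R) * monomial 1 1 := by
    rw [show ofR δ (↑s⁻¹ : R) * monomial 1 1 = (monomial 1 (↑s⁻¹ : R) : QPDO δ) from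
      monomial_mul_monomial_one 0 1 _]
    symm
    refine (eq_evenSeries_iff _ _ _).mpr ⟨fun n => ?_, fun i hi => ?_⟩
    · rw [coeff_monomial]
      cases n with
      | zero => simp [omegaCoeff]
      | succ n => rw [if_neg (by push_cast; omega)]; simp
    · rw [coeff_monomial, if_neg]
      intro h
      exact hi 0 (by simpa using h)
  have hinv : δ (↑s⁻¹ : R) = 0 := by
    have h := Derivation.leibniz δ (s : R) (↑s⁻¹ : R)
    rw [s.mul_inv, Derivation.map_one_eq_zero, hs0, smul_zero, add_zero, smul_eq_mul] at h
    exact s.isUnit.mul_right_eq_zero.mp h.symm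
  have hu : IsUnit (↑s⁻¹ : R) := s⁻¹.isUnit
  have hcomm := fun q : QPDO δ => ofR_mul_eq_mul_ofR q hinv
  have hsq : monomial 2 1 * ofR δ (↑(s ^ (-2 : ℤ)) : R) =
      ((monomial 1 1 * monomial 1 1) * (ofR δ (↑s⁻¹ : R) * ofR δ (↑s⁻¹ : R)) : QPDO δ) := by
    rw [monomial_mul_monomial_one, ← map_mul, zpow_neg, ← Units.val_mul, ← pow_two, inv_pow]
    rfl
  refine (existsUnique_sqrt (monomial 2 1 * ofR δ (↑(s ^ (-2 : ℤ)) : R)) (↑s⁻¹ : R) hu ?_ ?_).unique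
    ⟨vGe_evenSeries _ _, ?_, ?_⟩ ⟨hv, h1, h2⟩
  · rw [← h2, pow_two]; exact hv.mul hv
  · rw [← h2, pow_two, pow_two, ← h1]; exact hv.coeff_mul_eq hv
  · refine (coeff_evenSeries 1 _ 0).trans ?_
    simp [omegaCoeff]
  · rw [hW, hsq, pow_two, hcomm]
    rw [mul_assoc, ← mul_assoc (ofR δ _), hcomm]
    simp only [mul_assoc]

/-! ### All integer powers -/

/-- The powers of the square root `Y = s⁻¹ y + ⋯` of `y² s⁻²`. -/
theorem omegaSeries_eq_zpow [IsDomain R] (hs : δ (s : R) = algebraMap ℂ R (-(c / 2)))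
    {Y : (QPDO δ)ˣ} (hv : VGe (Y : QPDO δ) 1) (h1 : (Y : QPDO δ).coeff 1 = ↑s⁻¹)
    (h2 : (Y : QPDO δ) ^ 2 = monomial 2 1 * ofR δ (↑(s ^ (-2 : ℤ)) : R)) (k : ℤ) :
    (omegaSeries s c k : QPDO δ) = ((Y ^ k : (QPDO δ)ˣ) : QPDO δ) := by
  have step : ∀ k : ℤ, (omegaSeries s c (k + 2) : QPDO δ) =
      omegaSeries s c k * ((Y ^ (2 : ℤ) : (QPDO δ)ˣ) : QPDO δ) := fun k => by
    rw [omegaSeries_add_two hs, ← h2]; rfl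
  have key : ∀ j k : ℤ, (omegaSeries s c k : QPDO δ) = ((Y ^ k : (QPDO δ)ˣ) : QPDO δ) →
      (omegaSeries s c (k + 2 * j) : QPDO δ) = ((Y ^ (k + 2 * j) : (QPDO δ)ˣ) : QPDO δ) := by
    intro j k hk
    induction j using Int.induction_on with
    | zero => simpa using hk
    | succ j ih =>
      rw [show k + 2 * ((j : ℤ) + 1) = k + 2 * j + 2 by ring, step, ih, zpow_add Y _ 2,
        Units.val_mul]
    | pred j ih =>
      -- Downward, the recursion is read from the lower index and the invertible factor Y² is
      -- cancelled on the right.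
      have h := step (k + 2 * (-(j : ℤ) - 1))
      rw [show k + 2 * (-(j : ℤ) - 1) + 2 = k + 2 * -(j : ℤ) by ring, ih] at h
      rw [show k + 2 * -(j : ℤ) = k + 2 * (-(j : ℤ) - 1) + 2 by ring, zpow_add Y _ 2,
        Units.val_mul] at h
      exact ((Y ^ (2 : ℤ)).isUnit.mul_left_injective h).symm
  rcases Int.even_or_odd' k with ⟨j, rfl | rfl⟩
  · have := key j 0 (by rw [omegaSeries_zero]; simp)
    simpa using this
  · rw [add_comm]
    refine key j 1 ?_
    rw [omegaSeries_one_eq hs hv h1 h2, zpow_one]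

end Affine

end QPDO

/-! ### Specialisation to s = cz + d -/

namespace IsHomographicAlgebra

variable {U : Set ℂ} {Γ : Subgroup (Matrix.SpecialLinearGroup (Fin 2) ℂ)}
  {R : Subalgebra ℂ (FunGerm U)}

theorem coe_algebraMap (c : ℂ) :
    ((algebraMap ℂ R c : R) : FunGerm U) = ((fun _ => c : ℂ → ℂ) : FunGerm U) := by
  rw [Algebra.algebraMap_eq_smul_one]
  change ((fun _ => c * 1 : ℂ → ℂ) : FunGerm U) = _
  simp only [mul_one]

theorem partialZ_s (h : IsHomographicAlgebra U Γ R) (γ : Γ) :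
    h.partialZ (h.s γ : R) = algebraMap ℂ R (γ.1.1 1 0) := by
  refine Subtype.ext ((?_ : _ = _).trans (coe_algebraMap _).symm)
  change ((deriv (fun z => homDenom γ.1 z) : ℂ → ℂ) : FunGerm U) = _
  refine congrArg _ (funext fun z => ?_)
  have hd : HasDerivAt (fun z => homDenom γ.1 z) (γ.1.1 1 0 * 1) z :=
    ((hasDerivAt_id z).const_mul _).add_const _
  rw [hd.deriv, mul_one]

/-- The only point where the concrete form of s as an affine function of z is used. -/
theorem delta_s (h : IsHomographicAlgebra U Γ R) (γ : Γ) :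
    h.delta (h.s γ : R) = algebraMap ℂ R (-(γ.1.1 1 0 / 2)) := by
  rw [delta, Derivation.smul_apply, partialZ_s, Algebra.smul_def, ← map_mul]
  congr 1; ring

end IsHomographicAlgebra

theorem mainTheorem8 (U : Set ℂ) (Γ : Subgroup (Matrix.SpecialLinearGroup (Fin 2) ℂ))
    (R : Subalgebra ℂ (FunGerm U)) (h : IsHomographicAlgebra U Γ R) (γ : Γ) (k : ℤ) :
    QPDO.IsFormalSum
      (fun u : ℕ =>
        QPDO.ofR h.delta (omegaCoeff k u • ((↑(h.s γ ^ (-k)) : R) *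
          (algebraMap ℂ R (γ.1.1 1 0) * (↑(h.s γ)⁻¹ : R)) ^ u)) *
          ((QPDO.y h.delta ^ (2 * (u : ℤ) + k) : (QPDO h.delta)ˣ) : QPDO h.delta))
      (h.actC γ ((QPDO.y h.delta ^ k : (QPDO h.delta)ˣ) : QPDO h.delta)) := by
  have := h.isDomain
  have h2 := (h.yActVal_spec γ).2.2
  rw [← Units.val_pow_eq_pow_val, ← zpow_natCast, QPDO.y_zpow] at h2
  have hk := QPDO.omegaSeries_eq_zpow (Y := h.yAct γ) (h.delta_s γ) (h.yActVal_spec γ).1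
    (h.yActVal_spec γ).2.1 h2 k
  -- As y^k has the single coefficient 1, fixed by the action on R, the substitution yields the
  -- power of y·γ itself.
  have ha : h.actC γ ((QPDO.y h.delta ^ k : (QPDO h.delta)ˣ) : QPDO h.delta) =
      ((h.yAct γ ^ k : (QPDO h.delta)ˣ) : QPDO h.delta) := QPDO.subst_y_zpow _ _ _ _ k
  rw [ha, ← hk]
  exact QPDO.isFormalSum_evenSeries k _
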